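/- Let $\mathcal K$ be the C*-algebra of compact operators on $\ell^2(\mathbb N)$. Let $F$ be a (covariant) functor from the category of separable C*-algebras and *-homomorphisms to an additive category. Assume that $F$ is (1) split exact: for every exact sequence $0\to J\xrightarrow{j} E\xrightarrow{p} A\to 0$ of separable C*-algebras with a splitting *-homomorphism $s:A\to E$, $ps=\mathrm{id}_A$, the morphism $F(j)+F(s):F(J)\oplus F(A)\to F(E)$ is an isomorphism; and (2) stable: for every separable C*-algebra $A$, $F$ maps the natural embedding $A\to\mathcal K\otimes A$, $a\mapsto e_{00}\otimes a$ (with $e_{00}$ the rank-one projection onto the first basis vector), to an isomorphism. Let $A$ be a separable C*-algebra, let $A[0,1]$ be the C*-algebra of continuous $A$-valued functions on $[0,1]$, and let $\mathrm{ev}_0,\mathrm{ev}_1:A[0,1]\to A$ be the evaluations at $0$ and $1$. Let $CA=C_0([0,\infty),A)$. Then there is a *-isomorphism $\ker(\mathrm{ev}_1)\cong CA$ under which $\mathrm{ev}_0|_{\ker(\mathrm{ev}_1)}$ corresponds to evaluation at $0$ on $CA$, and $$F(\mathrm{ev}_0)=F(\mathrm{ev}_1).$$ Hence $F$ is homotopy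 invariant: if $\varphi,\psi:A\to B$ are *-homomorphisms between separable C*-algebras and there is a *-homomorphism $H:A\to B[0,1]$ with $\mathrm{ev}_0H=\varphi$ and $\mathrm{ev}_1H=\psi$, then $F(\varphi)=F(\psi)$. -/

import Mathlib

open CategoryTheory CategoryTheory.Limits
open scoped TensorProduct unitInterval NNReal ZeroAtInfty

universe u v w

/-! ### The compact operators on `ℓ²(ℕ)` -/

/-- The Hilbert space `ℓ²(ℕ)`. -/
abbrev ellTwo : Type := lp (fun _ : ℕ => ℂ) 2

namespace ellTwo

/-- The standard orthonormal basis of `ℓ²(ℕ)`. -/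
noncomputable def basis (i : ℕ) : ellTwo := lp.single 2 i 1

/-- The matrix unit `e_ij`, i.e. the rank-one operator `x ↦ ⟪e_j, x⟫ e_i`. -/
noncomputable def unit (i j : ℕ) : ellTwo →L[ℂ] ellTwo :=
  InnerProductSpace.rankOne ℂ (basis i) (basis j)

/-- The orthogonal projection onto the span of the first `n` basis vectors. -/
noncomputable def proj (n : ℕ) : ellTwo →L[ℂ] ellTwo := ∑ i ∈ Finset.range n, unit i i

lemma proj_apply (n : ℕ) (x : ellTwo) :
    proj n x = ∑ i ∈ Finset.range n, lp.single 2 i (x i) := by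
  simp [proj, unit, basis, lp.inner_single_left, ← lp.single_smul]

lemma norm_proj_apply_le (n : ℕ) (x : ellTwo) : ‖proj n x‖ ≤ ‖x‖ := by
  have hp : 0 < (2 : ENNReal).toReal := by norm_num
  have h1 := lp.norm_sum_single hp (fun i => x i) (Finset.range n)
  have h2 := lp.sum_rpow_le_norm_rpow hp x (Finset.range n)
  rw [proj_apply]
  rw [← Real.rpow_le_rpow_iff (norm_nonneg _) (norm_nonneg _) hp]
  exact h1.le.trans h2

lemma tendsto_proj_apply (x : ellTwo) :
    Filter.Tendsto (fun n => proj n x) Filter.atTop (nhds x) := by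
  simp only [proj_apply]
  exact (lp.hasSum_single (by norm_num) x).tendsto_sum_nat

lemma tendsto_proj_mul {T : ellTwo →L[ℂ] ellTwo} (hT : IsCompactOperator T) :
    Filter.Tendsto (fun n => proj n * T) Filter.atTop (nhds T) := by
  rw [Metric.tendsto_atTop]
  intro ε hε
  have hC : IsCompact (closure (T '' Metric.closedBall 0 1)) :=
    IsCompactOperator.isCompact_closure_image_closedBall (f := (T : ellTwo →ₗ[ℂ] ellTwo)) hT 1
  obtain ⟨t, htf, ht⟩ := Metric.totallyBounded_iff.1 hC.totallyBounded (ε / 6) (by positivity)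
  have hev : ∀ᶠ n in Filter.atTop, ∀ y ∈ t, dist (proj n y) y < ε / 6 := by
    rw [htf.eventually_all]
    intro y _
    exact (Metric.tendsto_nhds.1 (tendsto_proj_apply y)) _ (by positivity)
  obtain ⟨N, hN⟩ := Filter.eventually_atTop.1 hev
  refine ⟨N, fun n hn => ?_⟩
  rw [dist_eq_norm]
  refine lt_of_le_of_lt (ContinuousLinearMap.opNorm_le_of_unit_norm (C := ε / 2) (by positivity)
    fun x hx => ?_) (by linarith)
  have hmem : T x ∈ closure (T '' Metric.closedBall 0 1) :=
    subset_closure ⟨x, by simp [hx], rfl⟩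
  obtain ⟨y, hy, hxy⟩ := Set.mem_iUnion₂.1 (ht hmem)
  have h1 := hN n hn y hy
  have h2 := norm_proj_apply_le n (T x - y)
  rw [Metric.mem_ball, dist_eq_norm] at hxy
  rw [dist_eq_norm] at h1
  have : (proj n * T - T) x = proj n (T x - y) + (proj n y - y) - (T x - y) := by
    simp
  rw [this]
  have h3 := norm_sub_le (proj n (T x - y) + (proj n y - y)) (T x - y)
  have h4 := norm_add_le (proj n (T x - y)) (proj n y - y)
  linarith

lemma star_unit (i j : ℕ) : star (unit i j) = unit j i := by
  simp [unit, ContinuousLinearMap.star_eq_adjoint]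

lemma isCompactOperator_unit (i j : ℕ) : IsCompactOperator (unit i j) := by
  have h : unit i j = (ContinuousLinearMap.toSpanSingleton ℂ (basis i)).comp
      (innerSL ℂ (basis j)) := InnerProductSpace.rankOne_def' ..
  rw [h]
  exact (isCompactOperator_of_locallyCompactSpace_dom (innerSL ℂ (basis j))).clm_comp
    (ContinuousLinearMap.toSpanSingleton ℂ (basis i))

lemma isCompactOperator_proj (n : ℕ) : IsCompactOperator (proj n) := by
  exact Submodule.sum_mem (compactOperator (RingHom.id ℂ) ellTwo ellTwo)
    fun i _ => isCompactOperator_unit i i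

lemma star_proj (n : ℕ) : star (proj n) = proj n := by
  simp [proj, star_unit]

lemma isCompactOperator_star {T : ellTwo →L[ℂ] ellTwo} (hT : IsCompactOperator T) :
    IsCompactOperator ((star T : ellTwo →L[ℂ] ellTwo) : ellTwo → ellTwo) := by
  have h := (tendsto_proj_mul hT).star
  simp only [star_mul, star_proj] at h
  exact isClosed_setOfPred_isCompactOperator.mem_of_tendsto h
    (Filter.Eventually.of_forall fun n => (isCompactOperator_proj n).clm_comp (star T))

end ellTwo

/-- The C*-algebra `𝒦` of compact operators on `ℓ²(ℕ)`. -/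
def compactOps : NonUnitalStarSubalgebra ℂ (ellTwo →L[ℂ] ellTwo) where
  carrier := {T | IsCompactOperator T}
  add_mem' hf hg := IsCompactOperator.add hf hg
  zero_mem' := isCompactOperator_zero
  smul_mem' c _ hf := IsCompactOperator.smul hf c
  mul_mem' {_ T} hS _ := IsCompactOperator.comp_clm hS T
  star_mem' hT := ellTwo.isCompactOperator_star hT

instance isClosed_compactOps : IsClosed (compactOps : Set (ellTwo →L[ℂ] ellTwo)) :=
  isClosed_setOfPred_isCompactOperator

instance separableSpace_compactOps : TopologicalSpace.SeparableSpace compactOps := by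
  suffices h : TopologicalSpace.IsSeparable (compactOps : Set (ellTwo →L[ℂ] ellTwo)) from
    h.separableSpace
  let S : Submodule ℂ (ellTwo →L[ℂ] ellTwo) :=
    Submodule.span ℂ (Set.range fun p : ℕ × ℕ => ellTwo.unit p.1 p.2)
  have hS : TopologicalSpace.IsSeparable (S : Set (ellTwo →L[ℂ] ellTwo)) :=
    (Set.countable_range _).isSeparable.span
  refine hS.closure.mono fun T hT => ?_
  have h1 := ellTwo.tendsto_proj_mul hT
  have h2 := (ellTwo.tendsto_proj_mul (ellTwo.isCompactOperator_star hT)).star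
  simp only [star_mul, star_star, ellTwo.star_proj] at h2
  refine isClosed_closure.mem_of_tendsto h1 (Filter.Eventually.of_forall fun n => ?_)
  refine isClosed_closure.mem_of_tendsto (h2.const_mul (ellTwo.proj n))
    (Filter.Eventually.of_forall fun m => subset_closure ?_)
  have hu : ∀ i j, ellTwo.unit i i * (T * ellTwo.unit j j) =
      inner ℂ (ellTwo.basis i) (T (ellTwo.basis j)) • ellTwo.unit i j := by
    intro i j
    ext1 x
    simp [ellTwo.unit, smul_smul, mul_comm]
  simp only [ellTwo.proj, Finset.sum_mul, Finset.mul_sum, hu]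
  exact S.sum_mem fun i _ => S.sum_mem fun j _ => S.smul_mem _ (Submodule.subset_span ⟨(_, _), rfl⟩)

namespace compactOps

/-- The rank-one projection `e_00` as an element of `𝒦`. -/
noncomputable def minProj : compactOps := ⟨ellTwo.unit 0 0, ellTwo.isCompactOperator_unit 0 0⟩

lemma star_minProj : star minProj = minProj := Subtype.ext (ellTwo.star_unit 0 0)

lemma minProj_mul_minProj : minProj * minProj = minProj := by
  apply Subtype.ext
  have h : ‖ellTwo.basis 0‖ = 1 := by simp [ellTwo.basis, lp.norm_single]
  exact InnerProductSpace.isIdempotentElem_rankOne_self (𝕜 := ℂ) h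

end compactOps

/-! ### The tensor product of C*-algebras -/

/-- The algebraic tensor product `A ⊙ B` of two C*-algebras, with its usual *-algebra structure
`(a ⊗ b) (a' ⊗ b') = aa' ⊗ bb'`, `(a ⊗ b)* = a* ⊗ b*`. -/
def AlgTensor (A B : Type*) [NonUnitalCStarAlgebra A] [NonUnitalCStarAlgebra B] : Type _ :=
  A ⊗[ℂ] B

namespace AlgTensor

section

variable (A B : Type*) [NonUnitalCStarAlgebra A] [NonUnitalCStarAlgebra B]

noncomputable instance : NonUnitalRing (AlgTensor A B) :=
  inferInstanceAs (NonUnitalRing (A ⊗[ℂ] B))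

noncomputable instance : Module ℂ (AlgTensor A B) := inferInstanceAs (Module ℂ (A ⊗[ℂ] B))

instance : IsScalarTower ℂ (AlgTensor A B) (AlgTensor A B) :=
  inferInstanceAs (IsScalarTower ℂ (A ⊗[ℂ] B) (A ⊗[ℂ] B))

instance : SMulCommClass ℂ (AlgTensor A B) (AlgTensor A B) :=
  inferInstanceAs (SMulCommClass ℂ (A ⊗[ℂ] B) (A ⊗[ℂ] B))

noncomputable instance : StarRing (AlgTensor A B) := inferInstanceAs (StarRing (A ⊗[ℂ] B))

instance : StarModule ℂ (AlgTensor A B) := inferInstanceAs (StarModule ℂ (A ⊗[ℂ] B))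

/-- The bilinear map `(a, b) ↦ a ⊗ b`. -/
noncomputable def tmul : A →ₗ[ℂ] B →ₗ[ℂ] AlgTensor A B := TensorProduct.mk ℂ A B

end

variable {A B : Type*} [NonUnitalCStarAlgebra A] [NonUnitalCStarAlgebra B]

lemma tmul_mul_tmul (a a' : A) (b b' : B) :
    tmul A B a b * tmul A B a' b' = tmul A B (a * a') (b * b') :=
  Algebra.TensorProduct.tmul_mul_tmul a a' b b'

lemma star_tmul (a : A) (b : B) : star (tmul A B a b) = tmul A B (star a) (star b) :=
  TensorProduct.star_tmul a b

lemma span_tmul : Submodule.span ℂ {t : AlgTensor A B | ∃ a b, tmul A B a b = t} = ⊤ :=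
  TensorProduct.span_tmul_eq_top ℂ A B

/-- C*-seminorms on `A ⊙ B`. The estimate on elementary tensors holds for every C*-seminorm; it is
recorded so that the supremum below is visibly finite. -/
structure IsCStarSeminorm (p : Seminorm ℂ (AlgTensor A B)) : Prop where
  mul_le : ∀ x y, p (x * y) ≤ p x * p y
  star_mul_self : ∀ x, p (star x * x) = p x * p x
  tmul_le : ∀ a b, p (tmul A B a b) ≤ ‖a‖ * ‖b‖

variable (A B) in
/-- The C*-seminorms on `A ⊙ B`. -/
def CStarSeminorm : Type _ := {p : Seminorm ℂ (AlgTensor A B) // IsCStarSeminorm p}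

instance : Nonempty (CStarSeminorm A B) := by
  refine ⟨0, ⟨?_, ?_, ?_⟩⟩
  · intro x y; simp
  · intro x; simp
  · intro a b; simp only [zero_apply]; positivity

lemma bddAbove (x : AlgTensor A B) :
    BddAbove (Set.range fun p : CStarSeminorm A B => p.1 x) := by
  have hx : x ∈ Submodule.span ℂ {t : AlgTensor A B | ∃ a b, tmul A B a b = t} := by
    rw [span_tmul]; trivial
  induction hx using Submodule.span_induction with
  | mem x h =>
    obtain ⟨a, b, rfl⟩ := h
    exact ⟨‖a‖ * ‖b‖, by rintro _ ⟨p, rfl⟩; exact p.2.tmul_le a b⟩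
  | zero => exact ⟨0, by rintro _ ⟨p, rfl⟩; simp⟩
  | add x y _ _ hx hy =>
    obtain ⟨c, hc⟩ := hx
    obtain ⟨d, hd⟩ := hy
    refine ⟨c + d, ?_⟩
    rintro _ ⟨p, rfl⟩
    exact (map_add_le_add p.1 x y).trans (add_le_add (hc ⟨p, rfl⟩) (hd ⟨p, rfl⟩))
  | smul z x _ hx =>
    obtain ⟨c, hc⟩ := hx
    refine ⟨‖z‖ * c, ?_⟩
    rintro _ ⟨p, rfl⟩
    simp only [map_smul_eq_mul]
    exact mul_le_mul_of_nonneg_left (hc ⟨p, rfl⟩) (norm_nonneg z)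

/-- The largest C*-seminorm on `A ⊙ B`. It is the unique C*-norm on `A ⊙ B` as soon as `A` or `B`
is nuclear, in particular when `A` is the algebra of compact operators. -/
noncomputable def maxNorm (x : AlgTensor A B) : ℝ := ⨆ p : CStarSeminorm A B, p.1 x

lemma le_maxNorm (p : CStarSeminorm A B) (x : AlgTensor A B) : p.1 x ≤ maxNorm x :=
  le_ciSup (bddAbove x) p

lemma maxNorm_le {x : AlgTensor A B} {c : ℝ} (h : ∀ p : CStarSeminorm A B, p.1 x ≤ c) :
    maxNorm x ≤ c := ciSup_le h

lemma maxNorm_nonneg (x : AlgTensor A B) : 0 ≤ maxNorm x :=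
  Real.iSup_nonneg fun p => apply_nonneg p.1 x

lemma maxNorm_mul_le (x y : AlgTensor A B) : maxNorm (x * y) ≤ maxNorm x * maxNorm y :=
  maxNorm_le fun p => (p.2.mul_le x y).trans
    (mul_le_mul (le_maxNorm p x) (le_maxNorm p y) (apply_nonneg _ _) (maxNorm_nonneg x))

lemma IsCStarSeminorm.star_eq {p : Seminorm ℂ (AlgTensor A B)} (hp : IsCStarSeminorm p)
    (x : AlgTensor A B) : p (star x) = p x := by
  have key : ∀ y, p y ≤ p (star y) := by
    intro y
    rcases (apply_nonneg p y).eq_or_lt with h | h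
    · rw [← h]; exact apply_nonneg _ _
    · have h1 := (hp.star_mul_self y).symm.le.trans (hp.mul_le _ _)
      exact le_of_mul_le_mul_right h1 h
  exact le_antisymm (by simpa using key (star x)) (key x)

lemma maxNorm_star (x : AlgTensor A B) : maxNorm (star x) = maxNorm x :=
  iSup_congr fun p => p.2.star_eq x

lemma maxNorm_mul_self_le (x : AlgTensor A B) : maxNorm x * maxNorm x ≤ maxNorm (star x * x) := by
  have h : maxNorm x ≤ Real.sqrt (maxNorm (star x * x)) := maxNorm_le fun p =>
    Real.le_sqrt_of_sq_le (by rw [sq, ← p.2.star_mul_self]; exact le_maxNorm p _)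
  calc maxNorm x * maxNorm x ≤ _ := mul_self_le_mul_self (maxNorm_nonneg x) h
    _ = _ := Real.mul_self_sqrt (maxNorm_nonneg _)

lemma maxNorm_tmul_le (a : A) (b : B) : maxNorm (tmul A B a b) ≤ ‖a‖ * ‖b‖ :=
  maxNorm_le fun p => p.2.tmul_le a b

noncomputable instance : SeminormedAddCommGroup (AlgTensor A B) :=
  AddGroupSeminorm.toSeminormedAddCommGroup
    { toFun := maxNorm
      map_zero' := by simp [maxNorm]
      add_le' := fun x y => maxNorm_le fun p =>
        (map_add_le_add p.1 x y).trans (add_le_add (le_maxNorm p x) (le_maxNorm p y))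
      neg' := fun x => by simp [maxNorm] }

lemma norm_def (x : AlgTensor A B) : ‖x‖ = maxNorm x := rfl

noncomputable instance : NonUnitalSeminormedRing (AlgTensor A B) where
  dist_eq := SeminormedAddCommGroup.dist_eq
  norm_mul_le := maxNorm_mul_le

noncomputable instance : NormedSpace ℂ (AlgTensor A B) where
  norm_smul_le z x := maxNorm_le fun p => by
    rw [map_smul_eq_mul]
    exact mul_le_mul_of_nonneg_left (le_maxNorm p x) (norm_nonneg z)

instance : NormedStarGroup (AlgTensor A B) where
  norm_star_le x := (maxNorm_star x).le

end AlgTensor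

/-- The C*-algebraic tensor product `A ⊗ B`: the completion of `A ⊙ B` in its largest C*-seminorm
(elements of seminorm zero being identified with zero). -/
def CStarTensor (A B : Type*) [NonUnitalCStarAlgebra A] [NonUnitalCStarAlgebra B] : Type _ :=
  UniformSpace.Completion (AlgTensor A B)

namespace CStarTensor

open UniformSpace

variable {A B : Type*} [NonUnitalCStarAlgebra A] [NonUnitalCStarAlgebra B]

noncomputable instance : NormedAddCommGroup (CStarTensor A B) :=
  inferInstanceAs (NormedAddCommGroup (Completion (AlgTensor A B)))

noncomputable instance : NormedSpace ℂ (CStarTensor A B) :=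
  inferInstanceAs (NormedSpace ℂ (Completion (AlgTensor A B)))

instance : CompleteSpace (CStarTensor A B) :=
  inferInstanceAs (CompleteSpace (Completion (AlgTensor A B)))

/-- The canonical map `A ⊙ B → A ⊗ B`. -/
noncomputable def of : AlgTensor A B →ₗᵢ[ℂ] CStarTensor A B := Completion.toComplₗᵢ

lemma isDenseInducing_of : IsDenseInducing (of : AlgTensor A B → CStarTensor A B) :=
  Completion.isDenseInducing_coe

lemma denseRange_of : DenseRange (of : AlgTensor A B → CStarTensor A B) :=
  Completion.denseRange_coe

/-- The multiplication of `A ⊗ B`, extended continuously from `A ⊙ B`. -/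
noncomputable instance : Mul (CStarTensor A B) :=
  ⟨Function.curry <| (isDenseInducing_of.prodMap isDenseInducing_of).extend
    (of ∘ Function.uncurry (· * ·))⟩

/-- The involution of `A ⊗ B`, extended continuously from `A ⊙ B`. -/
noncomputable instance : Star (CStarTensor A B) :=
  ⟨Completion.map (star : AlgTensor A B → AlgTensor A B)⟩

lemma of_mul (x y : AlgTensor A B) : of (x * y) = of x * of y :=
  ((isDenseInducing_of.prodMap isDenseInducing_of).extend_eq
    (of.continuous.comp (continuous_mul (M := AlgTensor A B))) (x, y)).symm

lemma of_star (x : AlgTensor A B) : of (star x) = star (of x) :=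
  (Completion.map_coe (star_isometry (E := AlgTensor A B)).uniformContinuous x).symm

instance : ContinuousMul (CStarTensor A B) where
  continuous_mul := by
    let m := (AddMonoidHom.mul : AlgTensor A B →+ AlgTensor A B →+ AlgTensor A B).compr₂
      (Completion.toCompl (α := AlgTensor A B))
    have h : Continuous fun p : AlgTensor A B × AlgTensor A B => m p.1 p.2 :=
      (Completion.continuous_coe (AlgTensor A B)).comp continuous_mul
    have di : IsDenseInducing (Completion.toCompl : AlgTensor A B → Completion (AlgTensor A B)) :=
      Completion.isDenseInducing_coe
    exact (di.extend_Z_bilin di h :)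

instance : ContinuousStar (CStarTensor A B) where
  continuous_star := Completion.continuous_map (f := (star : AlgTensor A B → AlgTensor A B))

@[elab_as_elim]
lemma induction_on {P : CStarTensor A B → Prop} (x : CStarTensor A B) (hc : IsClosed {x | P x})
    (h : ∀ x : AlgTensor A B, P (of x)) : P x :=
  Completion.induction_on x hc h

noncomputable instance : NonUnitalRing (CStarTensor A B) where
  __ := (inferInstance : AddCommGroup (CStarTensor A B))
  left_distrib x y z := by
    induction x using induction_on with
    | hc => exact isClosed_eq (by fun_prop) (by fun_prop)
    | h x =>
    induction y using induction_on with
    | hc => exact isClosed_eq (by fun_prop) (by fun_prop)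
    | h y =>
    induction z using induction_on with
    | hc => exact isClosed_eq (by fun_prop) (by fun_prop)
    | h z => simp only [← of_mul, ← map_add, mul_add]
  right_distrib x y z := by
    induction x using induction_on with
    | hc => exact isClosed_eq (by fun_prop) (by fun_prop)
    | h x =>
    induction y using induction_on with
    | hc => exact isClosed_eq (by fun_prop) (by fun_prop)
    | h y =>
    induction z using induction_on with
    | hc => exact isClosed_eq (by fun_prop) (by fun_prop)
    | h z => simp only [← of_mul, ← map_add, add_mul]
  zero_mul x := by
    induction x using induction_on with
    | hc => exact isClosed_eq (by fun_prop) (by fun_prop)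
    | h x => rw [← map_zero (of (A := A) (B := B)), ← of_mul, zero_mul]
  mul_zero x := by
    induction x using induction_on with
    | hc => exact isClosed_eq (by fun_prop) (by fun_prop)
    | h x => rw [← map_zero (of (A := A) (B := B)), ← of_mul, mul_zero]
  mul_assoc x y z := by
    induction x using induction_on with
    | hc => exact isClosed_eq ((continuous_id.mul continuous_const).mul continuous_const) (continuous_id.mul continuous_const)
    | h x =>
    induction y using induction_on with
    | hc => exact isClosed_eq ((continuous_const.mul continuous_id).mul continuous_const) (continuous_const.mul (continuous_id.mul continuous_const))
    | h y =>
    induction z using induction_on with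
    | hc => exact isClosed_eq (continuous_const.mul continuous_id) (continuous_const.mul (continuous_const.mul continuous_id))
    | h z => simp only [← of_mul, mul_assoc]

noncomputable instance : NonUnitalNormedRing (CStarTensor A B) where
  dist_eq := NormedAddCommGroup.dist_eq
  norm_mul_le x y := by
    induction x using induction_on with
    | hc => exact isClosed_le (by fun_prop) (by fun_prop)
    | h x =>
    induction y using induction_on with
    | hc => exact isClosed_le (by fun_prop) (by fun_prop)
    | h y => rw [← of_mul, of.norm_map, of.norm_map, of.norm_map]; exact norm_mul_le x y

noncomputable instance : StarRing (CStarTensor A B) where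
  star_involutive x := by
    induction x using induction_on with
    | hc => exact isClosed_eq (by fun_prop) (by fun_prop)
    | h x => simp only [← of_star, star_star]
  star_mul x y := by
    induction x using induction_on with
    | hc => exact isClosed_eq (by fun_prop) (by fun_prop)
    | h x =>
    induction y using induction_on with
    | hc => exact isClosed_eq (by fun_prop) (by fun_prop)
    | h y => simp only [← of_star, ← of_mul, star_mul]
  star_add x y := by
    induction x using induction_on with
    | hc => exact isClosed_eq (by fun_prop) (by fun_prop)
    | h x =>
    induction y using induction_on with
    | hc => exact isClosed_eq (by fun_prop) (by fun_prop)
    | h y => simp only [← of_star, ← map_add, star_add]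

instance : CStarRing (CStarTensor A B) where
  norm_mul_self_le x := by
    induction x using induction_on with
    | hc => exact isClosed_le (by fun_prop) (by fun_prop)
    | h x =>
      rw [← of_star, ← of_mul, of.norm_map, of.norm_map]
      exact AlgTensor.maxNorm_mul_self_le x

instance : IsScalarTower ℂ (CStarTensor A B) (CStarTensor A B) where
  smul_assoc c x y := by
    induction x using induction_on with
    | hc => exact isClosed_eq ((continuous_id.const_smul c).mul continuous_const) ((continuous_id.mul continuous_const).const_smul c)
    | h x =>
    induction y using induction_on with
    | hc => exact isClosed_eq (continuous_const.mul continuous_id) ((continuous_const.mul continuous_id).const_smul c)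
    | h y => simp only [smul_eq_mul, ← of_mul, ← map_smul, smul_mul_assoc]

instance : SMulCommClass ℂ (CStarTensor A B) (CStarTensor A B) where
  smul_comm c x y := by
    induction x using induction_on with
    | hc => exact isClosed_eq ((continuous_id.mul continuous_const).const_smul c) (continuous_id.mul continuous_const)
    | h x =>
    induction y using induction_on with
    | hc => exact isClosed_eq ((continuous_const.mul continuous_id).const_smul c) (continuous_const.mul (continuous_id.const_smul c))
    | h y => simp only [smul_eq_mul, ← of_mul, ← map_smul, mul_smul_comm]

instance : StarModule ℂ (CStarTensor A B) where
  star_smul c x := by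
    induction x using induction_on with
    | hc => exact isClosed_eq (continuous_id.const_smul c).star (continuous_id.star.const_smul (star c))
    | h x => simp only [← of_star, ← map_smul, star_smul]

noncomputable instance : NonUnitalCStarAlgebra (CStarTensor A B) where
  complete := CompleteSpace.complete

/-- The elementary tensor `a ⊗ b` in `A ⊗ B`. -/
noncomputable def tmul (a : A) (b : B) : CStarTensor A B := of (AlgTensor.tmul A B a b)

lemma tmul_mul_tmul (a a' : A) (b b' : B) : tmul a b * tmul a' b' = tmul (a * a') (b * b') := by
  rw [tmul, tmul, ← of_mul, AlgTensor.tmul_mul_tmul]; rfl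

lemma star_tmul (a : A) (b : B) : star (tmul a b) = tmul (star a) (star b) := by
  rw [tmul, ← of_star, AlgTensor.star_tmul]; rfl

/-- For a projection `e` in `A`, the *-homomorphism `B → A ⊗ B`, `b ↦ e ⊗ b`. -/
noncomputable def projTensor (e : A) (he : star e = e) (he' : e * e = e) :
    B →⋆ₙₐ[ℂ] CStarTensor A B where
  toFun b := tmul e b
  map_smul' c b := by simp [tmul]
  map_zero' := by simp [tmul]
  map_add' b b' := by simp [tmul]
  map_mul' b b' := by rw [tmul_mul_tmul, he']
  map_star' b := by rw [star_tmul, he]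

lemma continuous_tmul : Continuous fun p : A × B => tmul p.1 p.2 := by
  let f : A →ₗ[ℂ] B →ₗ[ℂ] CStarTensor A B := (AlgTensor.tmul A B).compr₂ of.toLinearMap
  have h : ∀ a b, ‖f a b‖ ≤ 1 * ‖a‖ * ‖b‖ := fun a b => by
    rw [one_mul]
    exact (of.norm_map _).le.trans (AlgTensor.maxNorm_tmul_le a b)
  exact (f.mkContinuous₂ 1 h).continuous₂

instance [TopologicalSpace.SeparableSpace A] [TopologicalSpace.SeparableSpace B] :
    TopologicalSpace.SeparableSpace (CStarTensor A B) := by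
  rw [← TopologicalSpace.isSeparable_univ_iff]
  have h := (TopologicalSpace.isSeparable_range (continuous_tmul (A := A) (B := B))).span (R := ℂ)
  refine h.closure.mono fun x _ => ?_
  refine closure_mono ?_ (denseRange_of x)
  rintro _ ⟨y, rfl⟩
  have hy : y ∈ Submodule.span ℂ {t : AlgTensor A B | ∃ a b, AlgTensor.tmul A B a b = t} := by
    rw [AlgTensor.span_tmul]; trivial
  have := Submodule.mem_map_of_mem (f := of.toLinearMap) hy
  rw [Submodule.map_span] at this
  refine Submodule.span_mono ?_ this
  rintro _ ⟨_, ⟨a, b, rfl⟩, rfl⟩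
  exact ⟨(a, b), rfl⟩

end CStarTensor

/-! ### The category of separable C*-algebras -/

/-- Separable (not necessarily unital) C*-algebras. -/
structure SepCStarAlg : Type (u + 1) where
  carrier : Type u
  [cstar : NonUnitalCStarAlgebra carrier]
  [separable : TopologicalSpace.SeparableSpace carrier]

namespace SepCStarAlg

instance : CoeSort SepCStarAlg.{u} (Type u) := ⟨carrier⟩

instance (A : SepCStarAlg.{u}) : NonUnitalCStarAlgebra A := A.cstar

instance (A : SepCStarAlg.{u}) : TopologicalSpace.SeparableSpace A := A.separable

/-- The morphisms are the (not necessarily unital) *-homomorphisms. -/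
instance : Category SepCStarAlg.{u} where
  Hom A B := A →⋆ₙₐ[ℂ] B
  id A := NonUnitalStarAlgHom.id ℂ A
  comp f g := NonUnitalStarAlgHom.comp g f

/-- The *-homomorphism underlying a morphism. -/
def Hom.hom {A B : SepCStarAlg.{u}} (f : A ⟶ B) : A →⋆ₙₐ[ℂ] B := f

/-- A *-homomorphism as a morphism. -/
def ofHom {A B : SepCStarAlg.{u}} (f : A →⋆ₙₐ[ℂ] B) : A ⟶ B := f

/-- The stabilization `𝒦 ⊗ A`. -/
noncomputable def stabilization (A : SepCStarAlg.{u}) : SepCStarAlg.{u} :=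
  ⟨CStarTensor compactOps A⟩

/-- The natural embedding `A → 𝒦 ⊗ A`, `a ↦ e_00 ⊗ a`. -/
noncomputable def stabEmbedding (A : SepCStarAlg.{u}) : A ⟶ A.stabilization :=
  ofHom (CStarTensor.projTensor compactOps.minProj compactOps.star_minProj
    compactOps.minProj_mul_minProj)

/-- The C*-algebra `A[0,1]` of continuous `A`-valued functions on `[0,1]`. -/
noncomputable def path (A : SepCStarAlg.{u}) : SepCStarAlg.{u} := ⟨C(I, A)⟩

/-- The evaluation homomorphism `ev_t : A[0,1] → A`. -/
noncomputable def ev (A : SepCStarAlg.{u}) (t : I) : A.path ⟶ A :=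
  ofHom
    { toFun := fun f : C(I, A) => f t
      map_smul' := fun _ _ => rfl
      map_zero' := rfl
      map_add' := fun _ _ => rfl
      map_mul' := fun _ _ => rfl
      map_star' := fun _ => rfl }

/-- The kernel of `ev_1 : A[0,1] → A`. -/
def kerEvOne (A : SepCStarAlg.{u}) : NonUnitalStarSubalgebra ℂ C(I, A) where
  carrier := {f | f 1 = 0}
  add_mem' {f g} hf hg := by simp_all
  zero_mem' := by simp
  mul_mem' {f g} hf _ := by simp_all
  smul_mem' c f hf := by simp_all
  star_mem' {f} hf := by simp_all

lemma mem_kerEvOne (A : SepCStarAlg.{u}) (f : C(I, A)) :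
    f ∈ A.kerEvOne ↔ Hom.hom (A.ev 1) f = 0 := Iff.rfl

/-- Two *-homomorphisms `A → B` are homotopic if they are the endpoints of a *-homomorphism
`A → B[0,1]`. -/
def Homotopic {A B : SepCStarAlg.{u}} (φ ψ : A ⟶ B) : Prop :=
  ∃ H : A ⟶ B.path, H ≫ B.ev 0 = φ ∧ H ≫ B.ev 1 = ψ

/-- `0 → J → E → A → 0` (with maps `j`, `p`) is a short exact sequence of C*-algebras and the
*-homomorphism `s : A → E` is a splitting of it. -/
structure IsSplitExactSeq {J E A : SepCStarAlg.{u}} (j : J ⟶ E) (p : E ⟶ A) (s : A ⟶ E) :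
    Prop where
  injective : Function.Injective (Hom.hom j)
  exact : Function.Exact (Hom.hom j) (Hom.hom p)
  surjective : Function.Surjective (Hom.hom p)
  splitting : s ≫ p = 𝟙 A

end SepCStarAlg

section Functors

variable {C : Type v} [Category.{w} C] [Preadditive C] [HasZeroObject C] [HasBinaryBiproducts C]

/-- A functor `F` to an additive category (a preadditive category with a zero object and binary
biproducts) is split exact if
`F(j) + F(s) : F(J) ⊕ F(A) → F(E)` is an isomorphism for every split exact sequence
`0 → J → E → A → 0`. -/
def SplitExactFunctor (F : SepCStarAlg.{u} ⥤ C) : Prop :=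
  ∀ ⦃J E A : SepCStarAlg.{u}⦄ (j : J ⟶ E) (p : E ⟶ A) (s : A ⟶ E),
    SepCStarAlg.IsSplitExactSeq j p s → IsIso (biprod.desc (F.map j) (F.map s))

/-- A functor `F` is stable if it maps the natural embedding `A → 𝒦 ⊗ A` to an isomorphism for
every `A`. -/
def StableFunctor (F : SepCStarAlg.{u} ⥤ C) : Prop :=
  ∀ A : SepCStarAlg.{u}, IsIso (F.map A.stabEmbedding)

end Functors

/-! The equality `F(ev₀) = F(ev₁)` is an Eilenberg swindle over the binary tree of dyadic
subintervals of `[0,1]`.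

Sample functions along a sequence `x` in `[0,1]`. The pairs `(f, b)` with `b n - f (x n) → 0` form
an extension of `A[0,1]` by the null sequences `c₀(ℕ, A)`. Every sequence `y` with `x n - y n → 0`
gives a splitting `f ↦ (f, f ∘ y)`. The difference of the splittings for `x` and `y` dies in
`A[0,1]`, so split exactness yields a morphism `d(x, y) : F(A[0,1]) → F(c₀(ℕ, A))`. Its `n`-th entry
is `F(ev_{x n}) - F(ev_{y n})`, it restricts along injections of `ℕ` (`diff_comp_restrict`), and
`d(x, y) + d(y, z) = d(x, z)` (`diff_add`).

Let `x n` and `y n` be the left and right endpoints of the `n`-th dyadic interval; the lengths tend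
to zero, so `d = d(x, y)` exists. Restricted to left children and to right children, `d` becomes
`d(x, mid)` and `d(mid, y)`, whose sum is `d` again.

Let `D : c₀(ℕ, A) → 𝒦 ⊗ A` be the diagonal embedding. It is the orthogonal sum of the root entry and
its restrictions to the two families of children, each followed by a shift of `𝒦 ⊗ A`. Split
exactness makes `F` additive on orthogonal sums, and stability makes `F` send the shifts to
identities (`StableFunctor.map_stabShift`). Composing with `d` gives `d D = (F(ev₀) - F(ev₁)) F(e₀₀
⊗ ·) + d D`. Cancel `d D`, then the isomorphism `F(e₀₀ ⊗ ·)`.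

The cone identification is the reparametrization `t ↦ t / (1 + t)`, and homotopy invariance follows
by composing with the homotopy. -/

namespace SepCStarAlg

/-! ### Direct sums of separable C*-algebras -/

/-- The direct sum of two separable C*-algebras. -/
noncomputable def prod (A B : SepCStarAlg.{u}) : SepCStarAlg.{u} := ⟨A × B⟩

@[simp] lemma comp_apply {A B D : SepCStarAlg.{u}} (f : A ⟶ B) (g : B ⟶ D) (a : A) :
    Hom.hom (f ≫ g) a = Hom.hom g (Hom.hom f a) := rfl

lemma hom_ext {A B : SepCStarAlg.{u}} {f g : A ⟶ B} (h : ∀ a, Hom.hom f a = Hom.hom g a) :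
    f = g := DFunLike.ext (F := A →⋆ₙₐ[ℂ] B) _ _ h

/-- The first injection into a direct sum. -/
noncomputable def inl (A B : SepCStarAlg.{u}) : A ⟶ A.prod B :=
  ofHom (NonUnitalStarAlgHom.inl ℂ A B)

/-- The second injection into a direct sum. -/
noncomputable def inr (A B : SepCStarAlg.{u}) : B ⟶ A.prod B :=
  ofHom (NonUnitalStarAlgHom.inr ℂ A B)

/-- The first projection from a direct sum. -/
noncomputable def fst (A B : SepCStarAlg.{u}) : A.prod B ⟶ A :=
  ofHom (NonUnitalStarAlgHom.fst ℂ A B)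

/-- The second projection from a direct sum. -/
noncomputable def snd (A B : SepCStarAlg.{u}) : A.prod B ⟶ B :=
  ofHom (NonUnitalStarAlgHom.snd ℂ A B)

/-- The zero *-homomorphism. -/
noncomputable def zeroHom (A B : SepCStarAlg.{u}) : A ⟶ B := ofHom 0

lemma isSplitExactSeq_prod (A B : SepCStarAlg.{u}) :
    IsSplitExactSeq (inl A B) (snd A B) (inr A B) where
  injective _ _ h := congrArg Prod.fst h
  exact := by
    rintro ⟨a, b⟩
    constructor
    · intro h
      exact ⟨a, Prod.ext rfl (Eq.symm h)⟩
    · rintro ⟨c, h⟩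
      exact (congrArg Prod.snd h).symm
  surjective b := ⟨(0, b), rfl⟩
  splitting := rfl

end SepCStarAlg

/-! ### Formal consequences of split exactness -/

section Functors

open SepCStarAlg

variable {C : Type v} [Category.{w} C] [Preadditive C] [HasBinaryBiproducts C]
  {F : SepCStarAlg.{u} ⥤ C}

namespace SplitExactFunctor

lemma mono_map (hF : SplitExactFunctor F) {J E A : SepCStarAlg.{u}} {j : J ⟶ E} {p : E ⟶ A}
    {s : A ⟶ E} (h : IsSplitExactSeq j p s) : Mono (F.map j) := by
  have := hF j p s h
  rw [← biprod.inl_desc (F.map j) (F.map s)]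
  infer_instance

lemma hom_ext (hF : SplitExactFunctor F) {J E A : SepCStarAlg.{u}} {j : J ⟶ E} {p : E ⟶ A}
    {s : A ⟶ E} (h : IsSplitExactSeq j p s) {X : C} {f g : F.obj E ⟶ X}
    (hj : F.map j ≫ f = F.map j ≫ g) (hs : F.map s ≫ f = F.map s ≫ g) : f = g := by
  have := hF j p s h
  rw [← cancel_epi (biprod.desc (F.map j) (F.map s))]
  ext <;> simpa

/-- A zero map factors through the zero algebra `Z`, so it suffices that `F(Z) = 0`. The sequence `0
→ Z → Z → Z → 0` is split exact with all maps the identity; the codiagonal of `F(Z)` is then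
invertible, which forces its two injections to agree. -/
lemma map_zeroHom (hF : SplitExactFunctor F) (A B : SepCStarAlg.{u}) :
    F.map (zeroHom A B) = 0 := by
  -- Functions on the empty space give a zero algebra in the required universe.
  let Z : SepCStarAlg.{u} := ⟨C(PEmpty, A)⟩
  have hsub : Subsingleton Z := inferInstanceAs (Subsingleton C(PEmpty, A))
  have hZ : IsSplitExactSeq (𝟙 Z) (𝟙 Z) (𝟙 Z) :=
    { injective := fun _ _ h => h
      exact := fun z => ⟨fun _ => ⟨z, rfl⟩, fun _ => hsub.elim _ _⟩
      surjective := fun z => ⟨z, rfl⟩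
      splitting := rfl }
  have := hF _ _ _ hZ
  have h : (biprod.inl : F.obj Z ⟶ F.obj Z ⊞ F.obj Z) = biprod.inr := by
    rw [← cancel_mono (biprod.desc (F.map (𝟙 Z)) (F.map (𝟙 Z)))]
    simp
  have h0 : 𝟙 (F.obj Z) = 0 := by
    rw [← biprod.inl_fst (X := F.obj Z) (Y := F.obj Z), h, biprod.inr_fst]
  have hfac : zeroHom A B = zeroHom A Z ≫ 𝟙 Z ≫ zeroHom Z B := rfl
  rw [hfac, F.map_comp, F.map_comp, F.map_id, h0, zero_comp, comp_zero]

/-- Orthogonal *-homomorphisms have a sum, on which a split exact functor is additive. -/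
lemma exists_orthogonal_add (hF : SplitExactFunctor F) {A B : SepCStarAlg.{u}} {f g : A ⟶ B}
    (hfg : ∀ a b, Hom.hom f a * Hom.hom g b = 0) :
    ∃ h : A ⟶ B, (∀ a, Hom.hom h a = Hom.hom f a + Hom.hom g a) ∧
      F.map h = F.map f + F.map g := by
  -- Orthogonality on one side implies it on the other by taking adjoints.
  have hgf : ∀ a b, Hom.hom g a * Hom.hom f b = 0 := fun a b => by
    rw [← star_star (Hom.hom g a * Hom.hom f b), star_mul, ← map_star, ← map_star, hfg, star_zero]
  let k' : A × A →⋆ₙₐ[ℂ] B :=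
    { toFun := fun c : A × A => Hom.hom f c.1 + Hom.hom g c.2
      map_smul' := fun z c => by simp
      map_zero' := by simp
      map_add' := fun c d => by simp only [Prod.fst_add, Prod.snd_add, map_add]; abel
      map_mul' := fun c d => by simp [mul_add, add_mul, hfg, hgf]
      map_star' := fun c => by simp [map_star] }
  let k : A.prod A ⟶ B := ofHom k'
  let δ : A ⟶ A.prod A := ofHom (NonUnitalStarAlgHom.prod (NonUnitalStarAlgHom.id ℂ A)
    (NonUnitalStarAlgHom.id ℂ A))
  -- `F(A ⊕ A)` is the biproduct of two copies of `F(A)`. Inserting this decomposition of the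
  -- identity between the diagonal `δ` and `k` gives the sum.
  have hid : 𝟙 (F.obj (A.prod A)) =
      F.map (fst A A) ≫ F.map (inl A A) + F.map (snd A A) ≫ F.map (inr A A) := by
    refine hF.hom_ext (isSplitExactSeq_prod A A) ?_ ?_
    · have h1 : inl A A ≫ fst A A = 𝟙 A := rfl
      have h2 : inl A A ≫ snd A A = zeroHom A A := rfl
      rw [Preadditive.comp_add, ← F.map_comp_assoc, ← F.map_comp_assoc, h1, h2,
        hF.map_zeroHom]
      simp
    · have h1 : inr A A ≫ snd A A = 𝟙 A := rfl
      have h2 : inr A A ≫ fst A A = zeroHom A A := rfl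
      rw [Preadditive.comp_add, ← F.map_comp_assoc, ← F.map_comp_assoc, h1, h2,
        hF.map_zeroHom]
      simp
  have h2 : inl A A ≫ k = f := SepCStarAlg.hom_ext fun a =>
    (congrArg (Hom.hom f a + ·) (map_zero (Hom.hom g))).trans (add_zero _)
  have h3 : inr A A ≫ k = g := SepCStarAlg.hom_ext fun a =>
    (congrArg (· + Hom.hom g a) (map_zero (Hom.hom f))).trans (zero_add _)
  have h4 : δ ≫ fst A A = 𝟙 A := rfl
  have h5 : δ ≫ snd A A = 𝟙 A := rfl
  refine ⟨δ ≫ k, fun a => rfl, ?_⟩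
  calc F.map (δ ≫ k) = F.map δ ≫ 𝟙 _ ≫ F.map k := by rw [F.map_comp, Category.id_comp]
    _ = F.map f + F.map g := by
      rw [hid, Preadditive.add_comp, Preadditive.comp_add]
      simp only [← F.map_comp, Category.assoc, h2, h3]
      rw [reassoc_of% h4, reassoc_of% h5]

/-- The difference of two splittings of an extension factors through the ideal. -/
lemma exists_difference (hF : SplitExactFunctor F) {J E A : SepCStarAlg.{u}} {j : J ⟶ E}
    {p : E ⟶ A} {s : A ⟶ E} (h : IsSplitExactSeq j p s) {t : A ⟶ E} (ht : t ≫ p = 𝟙 A) :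
    ∃ d : F.obj A ⟶ F.obj J, d ≫ F.map j = F.map s - F.map t := by
  obtain ⟨D, hDj, hDs⟩ : ∃ D : F.obj J ⊞ F.obj A ≅ F.obj E,
      biprod.inl ≫ D.hom = F.map j ∧ biprod.inr ≫ D.hom = F.map s :=
    have := hF j p s h
    ⟨asIso (biprod.desc (F.map j) (F.map s)), by simp, by simp⟩
  have hjp : j ≫ p = zeroHom J A := SepCStarAlg.hom_ext fun a =>
    (h.exact (Hom.hom j a)).2 ⟨a, rfl⟩
  -- The retraction onto `F(J)` that kills `F(s)`; it need not come from a *-homomorphism.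
  let r : F.obj E ⟶ F.obj J := D.inv ≫ biprod.fst
  have hjr : F.map j ≫ r = 𝟙 _ := by
    rw [← hDj]; simp [r]
  have hsr : F.map s ≫ r = 0 := by
    rw [← hDs]; simp [r]
  have hid : r ≫ F.map j = 𝟙 _ - F.map p ≫ F.map s := by
    refine hF.hom_ext h ?_ ?_
    · rw [reassoc_of% hjr, Preadditive.comp_sub, ← F.map_comp_assoc, hjp, hF.map_zeroHom]
      simp
    · rw [reassoc_of% hsr, Preadditive.comp_sub, ← F.map_comp_assoc, h.splitting]
      simp
  -- Since `r ≫ F(j) = 1 - F(p) ≫ F(s)`, the error term is `(F(s) - F(t)) ≫ F(p) ≫ F(s)`, which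
  -- vanishes because `s` and `t` both split `p`.
  refine ⟨(F.map s - F.map t) ≫ r, ?_⟩
  rw [Category.assoc, hid, Preadditive.comp_sub, Preadditive.sub_comp (g := F.map p ≫ F.map s),
    ← F.map_comp_assoc, ← F.map_comp_assoc, h.splitting, ht]
  simp

end SplitExactFunctor

end Functors

/-! ### Null sequences and the algebra of sampled functions -/

section Sequences

open Filter Topology BoundedContinuousFunction

variable (A : Type u) [NonUnitalCStarAlgebra A]

/-- The C*-algebra `c₀(ℕ, A)` of null sequences in `A`, inside the algebra of bounded sequences. -/
def nullSeq : NonUnitalStarSubalgebra ℂ (ℕ →ᵇ A) where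
  carrier := {c | Tendsto c atTop (𝓝 0)}
  add_mem' hc hd := show Tendsto _ _ _ by simpa using! Tendsto.add hc hd
  zero_mem' := tendsto_const_nhds
  mul_mem' hc hd := show Tendsto _ _ _ by simpa using! Tendsto.mul hc hd
  smul_mem' z _ hc := show Tendsto _ _ _ by simpa using! Tendsto.const_smul hc z
  star_mem' hc := show Tendsto _ _ _ by simpa using! Tendsto.star hc

variable {A}

lemma mem_nullSeq {c : ℕ →ᵇ A} : c ∈ nullSeq A ↔ Tendsto c atTop (𝓝 0) := Iff.rfl

lemma mul_mem_nullSeq_right (b : ℕ →ᵇ A) {c : ℕ →ᵇ A} (hc : c ∈ nullSeq A) :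
    b * c ∈ nullSeq A := by
  rw [mem_nullSeq, tendsto_zero_iff_norm_tendsto_zero] at hc ⊢
  refine squeeze_zero (fun _ => norm_nonneg _) (fun n => (norm_mul_le (b n) (c n)).trans
    (mul_le_mul_of_nonneg_right (b.norm_coe_le_norm n) (norm_nonneg _))) ?_
  simpa using hc.const_mul ‖b‖

lemma mul_mem_nullSeq_left {c : ℕ →ᵇ A} (hc : c ∈ nullSeq A) (b : ℕ →ᵇ A) :
    c * b ∈ nullSeq A := by
  have h := star_mem (mul_mem_nullSeq_right (star b) (star_mem hc))
  rwa [star_mul, star_star, star_star] at h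

lemma isClosed_nullSeq : IsClosed (nullSeq A : Set (ℕ →ᵇ A)) := by
  refine isClosed_of_closure_subset fun c hc => ?_
  change Tendsto c atTop (𝓝 0)
  rw [Metric.tendsto_atTop]
  intro ε hε
  obtain ⟨d, hd, hcd⟩ := Metric.mem_closure_iff.1 hc (ε / 2) (by positivity)
  obtain ⟨N, hN⟩ := Metric.tendsto_atTop.1 (mem_nullSeq.1 hd) (ε / 2) (by positivity)
  refine ⟨N, fun n hn => ?_⟩
  have h1 := dist_triangle (c n) (d n) 0
  have h2 := dist_coe_le_dist (f := c) (g := d) n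
  have h3 := hN n hn
  linarith

instance : IsClosed (nullSeq A : Set (ℕ →ᵇ A)) := isClosed_nullSeq

/-- The sequence with the entries `c i` for `i < n` and zero elsewhere. -/
noncomputable def truncSeq (n : ℕ) (c : Fin n → A) : ℕ →ᵇ A :=
  BoundedContinuousFunction.ofNormedAddCommGroupDiscrete
    (fun i => if h : i < n then c ⟨i, h⟩ else 0) ‖c‖ fun i => by
      split_ifs with h
      · exact norm_le_pi_norm c _
      · simp

lemma truncSeq_apply (n : ℕ) (c : Fin n → A) (i : ℕ) :
    truncSeq n c i = if h : i < n then c ⟨i, h⟩ else 0 := rfl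

lemma continuous_truncSeq (n : ℕ) : Continuous (truncSeq (A := A) n) := by
  refine LipschitzWith.continuous (K := 1) (LipschitzWith.of_dist_le_mul fun c d => ?_)
  rw [NNReal.coe_one, one_mul, dist_le dist_nonneg]
  intro i
  rw [truncSeq_apply, truncSeq_apply]
  split_ifs with h
  · exact dist_le_pi_dist c d _
  · simp

lemma dist_truncSeq_le {c : ℕ →ᵇ A} {n : ℕ} {ε : ℝ} (hε : 0 ≤ ε) (h : ∀ i ≥ n, ‖c i‖ ≤ ε) :
    dist c (truncSeq n fun i => c i) ≤ ε := by
  rw [dist_le hε]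
  intro i
  rw [truncSeq_apply]
  split_ifs with hi
  · simpa using hε
  · simpa using h i (by omega)

instance [TopologicalSpace.SeparableSpace A] : TopologicalSpace.SeparableSpace (nullSeq A) := by
  suffices h : TopologicalSpace.IsSeparable (nullSeq A : Set (ℕ →ᵇ A)) from h.separableSpace
  have h : TopologicalSpace.IsSeparable (⋃ n, Set.range (truncSeq (A := A) n)) :=
    TopologicalSpace.IsSeparable.iUnion fun n =>
      TopologicalSpace.isSeparable_range (continuous_truncSeq n)
  refine h.closure.mono fun c hc => Metric.mem_closure_iff.2 fun ε hε => ?_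
  obtain ⟨N, hN⟩ := Metric.tendsto_atTop.1 (mem_nullSeq.1 hc) (ε / 2) (by positivity)
  refine ⟨_, Set.mem_iUnion.2 ⟨N, _, rfl⟩, (dist_truncSeq_le (n := N) (half_pos hε).le
    fun i hi => ?_).trans_lt (half_lt_self hε)⟩
  simpa using (hN i hi).le

/-- Reindexing bounded sequences along `τ`. -/
noncomputable def reindex (A : Type u) [NonUnitalCStarAlgebra A] (τ : ℕ → ℕ) :
    (ℕ →ᵇ A) →⋆ₙₐ[ℂ] (ℕ →ᵇ A) where
  toFun b := b.compContinuous ⟨τ, continuous_of_discreteTopology⟩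
  map_smul' _ _ := rfl
  map_zero' := rfl
  map_add' _ _ := rfl
  map_mul' _ _ := rfl
  map_star' _ := rfl

@[simp] lemma reindex_apply (τ : ℕ → ℕ) (b : ℕ →ᵇ A) (n : ℕ) : reindex A τ b n = b (τ n) := rfl

lemma reindex_mem {τ : ℕ → ℕ} (hτ : Function.Injective τ) {c : ℕ →ᵇ A} (hc : c ∈ nullSeq A) :
    reindex A τ c ∈ nullSeq A :=
  (mem_nullSeq.1 hc).comp hτ.nat_tendsto_atTop

/-- Sampling a continuous function at the points `x n`. -/
noncomputable def sample (A : Type u) [NonUnitalCStarAlgebra A] (x : ℕ → I) :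
    C(I, A) →⋆ₙₐ[ℂ] (ℕ →ᵇ A) where
  toFun f := (mkOfCompact f).compContinuous ⟨x, continuous_of_discreteTopology⟩
  map_smul' _ _ := rfl
  map_zero' := rfl
  map_add' _ _ := rfl
  map_mul' _ _ := rfl
  map_star' _ := rfl

@[simp] lemma sample_apply (x : ℕ → I) (f : C(I, A)) (n : ℕ) : sample A x f n = f (x n) := rfl

/-- The pairs `(f, b)` of a function and a bounded sequence with `b n - f (x n) → 0`. -/
def sampleAlg (A : Type u) [NonUnitalCStarAlgebra A] (x : ℕ → I) :
    NonUnitalStarSubalgebra ℂ (C(I, A) × (ℕ →ᵇ A)) where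
  carrier := {q | q.2 - sample A x q.1 ∈ nullSeq A}
  add_mem' {q r} hq hr := by
    have := add_mem (s := nullSeq A) hq hr
    simp only [Set.mem_ofPred_eq, Prod.fst_add, Prod.snd_add, map_add]
    rwa [add_sub_add_comm]
  zero_mem' := by
    simp only [Set.mem_ofPred_eq, Prod.fst_zero, Prod.snd_zero, map_zero, sub_zero]
    exact zero_mem _
  mul_mem' {q r} hq hr := by
    -- With `f̂` for the sampled function, `b b' - f̂ f̂' = b (b' - f̂') + (b - f̂) f̂'`, and null
    -- sequences form a two-sided ideal.
    have := add_mem (s := nullSeq A) (mul_mem_nullSeq_right q.2 hr)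
      (mul_mem_nullSeq_left hq (sample A x r.1))
    simp only [Set.mem_ofPred_eq, Prod.fst_mul, Prod.snd_mul, map_mul]
    rwa [mul_sub, sub_mul, sub_add_sub_cancel] at this
  smul_mem' z q hq := by
    simp only [Set.mem_ofPred_eq, Prod.smul_fst, Prod.smul_snd, map_smul, ← smul_sub]
    exact SMulMemClass.smul_mem z hq
  star_mem' {q} hq := by
    simp only [Set.mem_ofPred_eq, Prod.fst_star, Prod.snd_star, map_star, ← star_sub]
    exact star_mem (S := NonUnitalStarSubalgebra ℂ (ℕ →ᵇ A)) hq

lemma mem_sampleAlg {x : ℕ → I} {q : C(I, A) × (ℕ →ᵇ A)} :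
    q ∈ sampleAlg A x ↔ q.2 - sample A x q.1 ∈ nullSeq A := Iff.rfl

lemma continuous_sample (x : ℕ → I) : Continuous (sample A x) := by
  open scoped CStarAlgebra in exact map_continuous _

instance (x : ℕ → I) : IsClosed (sampleAlg A x : Set (C(I, A) × (ℕ →ᵇ A))) :=
  isClosed_nullSeq.preimage (continuous_snd.sub ((continuous_sample x).comp continuous_fst))

instance [TopologicalSpace.SeparableSpace A] (x : ℕ → I) :
    TopologicalSpace.SeparableSpace (sampleAlg A x) := by
  suffices h : TopologicalSpace.IsSeparable (sampleAlg A x : Set (C(I, A) × (ℕ →ᵇ A))) from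
    h.separableSpace
  -- Bounded sequences need not form a separable space, so separability is obtained by parametrizing
  -- the algebra by a function and a null sequence.
  have h : Continuous fun q : C(I, A) × nullSeq A => (q.1, sample A x q.1 + (q.2 : ℕ →ᵇ A)) :=
    continuous_fst.prodMk (((continuous_sample x).comp continuous_fst).add
      (continuous_subtype_val.comp continuous_snd))
  refine (TopologicalSpace.isSeparable_range h).mono fun q hq => ⟨(q.1, ⟨_, hq⟩), ?_⟩
  simp

/-- The difference of the sequences `x` and `y` tends to zero. -/
def Asymptotic (x y : ℕ → I) : Prop := Tendsto (fun n => (x n, y n)) atTop (uniformity I)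

lemma Asymptotic.comp {x y : ℕ → I} (h : Asymptotic x y) {τ : ℕ → ℕ}
    (hτ : Function.Injective τ) : Asymptotic (x ∘ τ) (y ∘ τ) :=
  Tendsto.comp h hτ.nat_tendsto_atTop

lemma Asymptotic.refl (x : ℕ → I) : Asymptotic x x := tendsto_diag_uniformity x atTop

lemma Asymptotic.symm {x y : ℕ → I} (h : Asymptotic x y) : Asymptotic y x :=
  Tendsto.uniformity_symm h

lemma Asymptotic.trans {x y z : ℕ → I} (h : Asymptotic x y) (h' : Asymptotic y z) :
    Asymptotic x z := Tendsto.uniformity_trans h h'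

/-- Uniform continuity of `f` on the compact interval. This is what makes asymptotic sequences give
splittings of the same extension. -/
lemma Asymptotic.sample_sub_mem {x y : ℕ → I} (h : Asymptotic x y) (f : C(I, A)) :
    sample A x f - sample A y f ∈ nullSeq A := by
  have hf := Tendsto.comp (CompactSpace.uniformContinuous_of_continuous f.continuous) h
  change Tendsto (fun n => (f (x n), f (y n))) atTop (uniformity A) at hf
  rw [tendsto_uniformity_iff_dist_tendsto_zero] at hf
  rw [mem_nullSeq, tendsto_zero_iff_norm_tendsto_zero]
  simpa [dist_eq_norm] using hf

end Sequences

/-! ### The sampling extension and its splittings -/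

namespace SepCStarAlg

open BoundedContinuousFunction

variable (A : SepCStarAlg.{u})

/-- The null sequences in a separable C*-algebra. -/
noncomputable def nullSeq : SepCStarAlg.{u} := ⟨_root_.nullSeq A⟩

/-- The extension of `A[0,1]` by the null sequences in `A` given by sampling along `x`. -/
noncomputable def sampleExt (x : ℕ → I) : SepCStarAlg.{u} := ⟨sampleAlg A x⟩

/-- The inclusion of the null sequences into the sampling extension. -/
noncomputable def sampleIncl (x : ℕ → I) : A.nullSeq ⟶ A.sampleExt x :=
  ofHom (NonUnitalStarAlgHom.codRestrict
    ((NonUnitalStarAlgHom.inr ℂ C(I, A) (ℕ →ᵇ A)).comp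
      (NonUnitalStarSubalgebraClass.subtype (_root_.nullSeq A))) (sampleAlg A x) fun c => by
        rw [mem_sampleAlg]
        change (c : ℕ →ᵇ A) - sample A x 0 ∈ _root_.nullSeq A
        rw [map_zero, sub_zero]
        exact c.2)

/-- The projection of the sampling extension. -/
noncomputable def sampleProj (x : ℕ → I) : A.sampleExt x ⟶ A.path :=
  ofHom ((NonUnitalStarAlgHom.fst ℂ C(I, A) (ℕ →ᵇ A)).comp
    (NonUnitalStarSubalgebraClass.subtype (sampleAlg A x)))

/-- The splitting `f ↦ (f, f ∘ y)` of the sampling extension along `x`. -/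
noncomputable def sampleSec {x y : ℕ → I} (h : Asymptotic x y) : A.path ⟶ A.sampleExt x :=
  ofHom (NonUnitalStarAlgHom.codRestrict
    ((NonUnitalStarAlgHom.id ℂ C(I, A)).prod (sample A y)) (sampleAlg A x)
      fun f => h.symm.sample_sub_mem f)

/-- Restriction of null sequences along `τ`. -/
noncomputable def nullSeqRestrict {τ : ℕ → ℕ} (hτ : Function.Injective τ) :
    A.nullSeq ⟶ A.nullSeq :=
  ofHom (NonUnitalStarAlgHom.codRestrict ((reindex A τ).comp
    (NonUnitalStarSubalgebraClass.subtype (_root_.nullSeq A))) (_root_.nullSeq A)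
      fun c => reindex_mem hτ c.2)

/-- The morphism of sampling extensions induced by `τ`. -/
noncomputable def sampleRestrict {τ : ℕ → ℕ} (hτ : Function.Injective τ) {x y : ℕ → I}
    (h : Asymptotic (x ∘ τ) y) : A.sampleExt x ⟶ A.sampleExt y :=
  ofHom (NonUnitalStarAlgHom.codRestrict
    (((NonUnitalStarAlgHom.fst ℂ C(I, A) (ℕ →ᵇ A)).prod
      ((reindex A τ).comp (NonUnitalStarAlgHom.snd ℂ C(I, A) (ℕ →ᵇ A)))).comp
        (NonUnitalStarSubalgebraClass.subtype (sampleAlg A x))) (sampleAlg A y) fun q => by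
          have h1 := add_mem (reindex_mem hτ (mem_sampleAlg.1 q.2)) (h.sample_sub_mem q.1.1)
          rw [map_sub] at h1
          change _ - sample A (x ∘ τ) q.1.1 + _ ∈ _ at h1
          rwa [sub_add_sub_cancel] at h1)

/-- The `n`-th entry of a null sequence. -/
noncomputable def nullSeqEval (n : ℕ) : A.nullSeq ⟶ A :=
  ofHom
    { toFun := fun c : _root_.nullSeq A => (c : ℕ →ᵇ A) n
      map_smul' := fun _ _ => rfl
      map_zero' := rfl
      map_add' := fun _ _ => rfl
      map_mul' := fun _ _ => rfl
      map_star' := fun _ => rfl }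

/-- The `n`-th entry of the sequence part of an element of the sampling extension. -/
noncomputable def sampleEval (x : ℕ → I) (n : ℕ) : A.sampleExt x ⟶ A :=
  ofHom
    { toFun := fun q : sampleAlg A x => (q : C(I, A) × (ℕ →ᵇ A)).2 n
      map_smul' := fun _ _ => rfl
      map_zero' := rfl
      map_add' := fun _ _ => rfl
      map_mul' := fun _ _ => rfl
      map_star' := fun _ => rfl }

lemma sampleIncl_comp_eval (x : ℕ → I) (n : ℕ) :
    A.sampleIncl x ≫ A.sampleEval x n = A.nullSeqEval n := rfl

lemma sampleSec_comp_eval {x y : ℕ → I} (h : Asymptotic x y) (n : ℕ) :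
    A.sampleSec h ≫ A.sampleEval x n = A.ev (y n) := rfl

lemma sampleSec_comp_proj {x y : ℕ → I} (h : Asymptotic x y) :
    A.sampleSec h ≫ A.sampleProj x = 𝟙 A.path := rfl

lemma sampleIncl_comp_restrict {τ : ℕ → ℕ} (hτ : Function.Injective τ) {x y : ℕ → I}
    (h : Asymptotic (x ∘ τ) y) :
    A.sampleIncl x ≫ A.sampleRestrict hτ h = A.nullSeqRestrict hτ ≫ A.sampleIncl y := rfl

lemma sampleSec_comp_restrict {τ : ℕ → ℕ} (hτ : Function.Injective τ) {x y z : ℕ → I}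
    (h : Asymptotic (x ∘ τ) y) (hz : Asymptotic x z) :
    A.sampleSec hz ≫ A.sampleRestrict hτ h =
      A.sampleSec (h.symm.trans (hz.comp hτ)) := rfl

lemma isSplitExactSeq_sample (x : ℕ → I) :
    IsSplitExactSeq (A.sampleIncl x) (A.sampleProj x) (A.sampleSec (.refl x)) where
  injective c d h := Subtype.ext (congrArg (fun q : sampleAlg A x => q.1.2) h)
  exact q := by
    obtain ⟨⟨f, b⟩, hq⟩ := q
    constructor
    · intro (hf : f = 0)
      subst hf
      rw [mem_sampleAlg, map_zero, sub_zero] at hq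
      exact ⟨⟨b, hq⟩, rfl⟩
    · rintro ⟨c, hc⟩
      exact (congrArg (fun q : sampleAlg A x => q.1.1) hc).symm
  surjective f := ⟨Hom.hom (A.sampleSec (.refl x)) f, rfl⟩
  splitting := rfl

end SepCStarAlg

/-! ### Difference morphisms of asymptotic sequences -/

section Functors

open SepCStarAlg

variable {C : Type v} [Category.{w} C] [Preadditive C] [HasBinaryBiproducts C]
  {F : SepCStarAlg.{u} ⥤ C}

namespace SplitExactFunctor

/-- The morphism `F(A[0,1]) → F(c₀(ℕ, A))` defined by the formal difference of sampling along
`x` and along `y`. -/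
noncomputable def diff (hF : SplitExactFunctor F) (A : SepCStarAlg.{u}) {x y : ℕ → I}
    (h : Asymptotic x y) : F.obj A.path ⟶ F.obj A.nullSeq :=
  (hF.exists_difference (A.isSplitExactSeq_sample x) (A.sampleSec_comp_proj h)).choose

lemma diff_comp (hF : SplitExactFunctor F) (A : SepCStarAlg.{u}) {x y : ℕ → I}
    (h : Asymptotic x y) : hF.diff A h ≫ F.map (A.sampleIncl x) =
      F.map (A.sampleSec (.refl x)) - F.map (A.sampleSec h) :=
  (hF.exists_difference (A.isSplitExactSeq_sample x) (A.sampleSec_comp_proj h)).choose_spec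

lemma diff_comp_eval (hF : SplitExactFunctor F) (A : SepCStarAlg.{u}) {x y : ℕ → I}
    (h : Asymptotic x y) (n : ℕ) : hF.diff A h ≫ F.map (A.nullSeqEval n) =
      F.map (A.ev (x n)) - F.map (A.ev (y n)) := by
  rw [← A.sampleIncl_comp_eval x n, F.map_comp, ← Category.assoc, hF.diff_comp,
    Preadditive.sub_comp, ← F.map_comp, ← F.map_comp, sampleSec_comp_eval, sampleSec_comp_eval]

/-- Naturality of the difference construction under the map of extensions given by `τ`. The target
is sampled along any `z` asymptotic to `x ∘ τ`, so the same formula covers both reindexing and a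
change of base sequence. -/
lemma diff_comp_restrict_comp (hF : SplitExactFunctor F) (A : SepCStarAlg.{u}) {x y z : ℕ → I}
    (h : Asymptotic x y) {τ : ℕ → ℕ} (hτ : Function.Injective τ) (hz : Asymptotic (x ∘ τ) z) :
    hF.diff A h ≫ F.map (A.nullSeqRestrict hτ) ≫ F.map (A.sampleIncl z) =
      F.map (A.sampleSec hz.symm) -
        F.map (A.sampleSec (hz.symm.trans (h.comp hτ))) := by
  rw [← F.map_comp, ← A.sampleIncl_comp_restrict hτ hz, F.map_comp, ← Category.assoc,
    hF.diff_comp, Preadditive.sub_comp, ← F.map_comp, ← F.map_comp, sampleSec_comp_restrict,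
    sampleSec_comp_restrict]

/-- A difference morphism is determined by its composite with the monomorphism `F(c₀) → F(E)`, so
the arbitrary choice in `diff` does no harm. -/
lemma diff_comp_restrict (hF : SplitExactFunctor F) (A : SepCStarAlg.{u}) {x y : ℕ → I}
    (h : Asymptotic x y) {τ : ℕ → ℕ} (hτ : Function.Injective τ) :
    hF.diff A h ≫ F.map (A.nullSeqRestrict hτ) = hF.diff A (h.comp hτ) := by
  have := hF.mono_map (A.isSplitExactSeq_sample (x ∘ τ))
  rw [← cancel_mono (F.map (A.sampleIncl (x ∘ τ))), hF.diff_comp, Category.assoc,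
    hF.diff_comp_restrict_comp A h hτ (.refl _)]

lemma diff_add (hF : SplitExactFunctor F) (A : SepCStarAlg.{u}) {x y z : ℕ → I}
    (h : Asymptotic x y) (h' : Asymptotic y z) :
    hF.diff A h + hF.diff A h' = hF.diff A (h.trans h') := by
  have := hF.mono_map (A.isSplitExactSeq_sample x)
  -- Reindexing by the identity moves the second difference from the extension along `y` to the one
  -- along `x`, where the sum telescopes.
  have h1 := hF.diff_comp_restrict_comp A h' Function.injective_id (z := x) h.symm
  have h2 : A.nullSeqRestrict Function.injective_id = 𝟙 _ := rfl
  rw [h2, F.map_id, Category.id_comp] at h1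
  rw [← cancel_mono (F.map (A.sampleIncl x)), Preadditive.add_comp, h1, hF.diff_comp,
    hF.diff_comp]
  exact sub_add_sub_cancel _ _ _

end SplitExactFunctor

end Functors

/-! ### Infinite sums of orthogonal *-homomorphisms -/

section DiagonalSum

open Filter Topology BoundedContinuousFunction

variable {A : Type u} {B : Type*} [NonUnitalCStarAlgebra A] [NonUnitalCStarAlgebra B]
  {ε : ℕ → A →⋆ₙₐ[ℂ] B}

/-- The finite sum `b ↦ ∑ i ∈ s, ε i (b i)` of orthogonal *-homomorphisms. -/
noncomputable def finsetSum (hε : ∀ i j, i ≠ j → ∀ a b, ε i a * ε j b = 0) (s : Finset ℕ) :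
    (ℕ →ᵇ A) →⋆ₙₐ[ℂ] B where
  toFun b := ∑ i ∈ s, ε i (b i)
  map_smul' z b := by simp [Finset.smul_sum]
  map_zero' := by simp
  map_add' b c := by simp [Finset.sum_add_distrib]
  map_mul' b c := by
    rw [Finset.sum_mul_sum]
    refine Finset.sum_congr rfl fun i hi => ?_
    rw [Finset.sum_eq_single i (fun j _ hj => hε i j hj.symm _ _) (fun h => absurd hi h),
      ← map_mul]
    rfl
  map_star' b := by simp [star_sum, map_star]

/-- By orthogonality the finite sum is itself a *-homomorphism, hence contractive; the bound is
therefore independent of `s`. -/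
lemma norm_sum_orthogonal_le (hε : ∀ i j, i ≠ j → ∀ a b, ε i a * ε j b = 0) (s : Finset ℕ)
    (b : ℕ →ᵇ A) : ‖∑ i ∈ s, ε i (b i)‖ ≤ ‖b‖ :=
  NonUnitalStarAlgHom.norm_apply_le (finsetSum hε s) b

lemma summable_orthogonal (hε : ∀ i j, i ≠ j → ∀ a b, ε i a * ε j b = 0) (c : nullSeq A) :
    Summable fun i => ε i ((c : ℕ →ᵇ A) i) := by
  rw [summable_iff_vanishing_norm]
  intro r hr
  obtain ⟨N, hN⟩ := Metric.tendsto_atTop.1 (mem_nullSeq.1 c.2) (r / 2) (by positivity)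
  refine ⟨Finset.range N, fun t ht => ?_⟩
  -- Removing the first `N` entries makes the norm at most `r / 2` without changing the sum over
  -- `t`, which avoids those indices.
  have h1 := norm_sum_orthogonal_le hε t ((c : ℕ →ᵇ A) - truncSeq N fun i => (c : ℕ →ᵇ A) i)
  have h2 : ‖(c : ℕ →ᵇ A) - truncSeq N fun i => (c : ℕ →ᵇ A) i‖ ≤ r / 2 := by
    rw [← dist_eq_norm]
    exact dist_truncSeq_le (half_pos hr).le fun i hi => by simpa using (hN i hi).le
  have h3 : ∑ i ∈ t, ε i (((c : ℕ →ᵇ A) - truncSeq N fun i => (c : ℕ →ᵇ A) i) i) =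
      ∑ i ∈ t, ε i ((c : ℕ →ᵇ A) i) := by
    refine Finset.sum_congr rfl fun i hi => ?_
    have hiN : ¬ i < N := fun h => Finset.disjoint_left.1 ht hi (Finset.mem_range.2 h)
    rw [BoundedContinuousFunction.sub_apply, truncSeq_apply, dif_neg hiN, sub_zero]
  rw [h3] at h1
  linarith

/-- The sum `c ↦ ∑ i, ε i (c i)` of orthogonal *-homomorphisms, on null sequences. -/
noncomputable def diagSum (hε : ∀ i j, i ≠ j → ∀ a b, ε i a * ε j b = 0) :
    nullSeq A →⋆ₙₐ[ℂ] B where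
  toFun c := ∑' i, ε i ((c : ℕ →ᵇ A) i)
  map_smul' z c := by
    simpa using (summable_orthogonal hε c).tsum_const_smul z
  map_zero' := by simp
  map_add' b c := by
    simpa using (summable_orthogonal hε b).tsum_add (summable_orthogonal hε c)
  map_mul' b c := by
    rw [← ((summable_orthogonal hε b).hasSum.mul_right _).tsum_eq]
    refine tsum_congr fun i => ?_
    rw [← ((summable_orthogonal hε c).hasSum.mul_left _).tsum_eq,
      tsum_eq_single i fun j hj => hε i j hj.symm _ _, ← map_mul]
    rfl
  map_star' b := by
    simpa [map_star] using (tsum_star (f := fun i => ε i ((b : ℕ →ᵇ A) i))).symm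

lemma hasSum_diagSum (hε : ∀ i j, i ≠ j → ∀ a b, ε i a * ε j b = 0) (c : nullSeq A) :
    HasSum (fun i => ε i ((c : ℕ →ᵇ A) i)) (diagSum hε c) :=
  (summable_orthogonal hε c).hasSum

end DiagonalSum

/-! ### Functoriality of the maximal tensor product in the left factor -/

namespace AlgTensor

variable {A A' B : Type*} [NonUnitalCStarAlgebra A] [NonUnitalCStarAlgebra A']
  [NonUnitalCStarAlgebra B]

lemma induction_on {P : AlgTensor A B → Prop} (x : AlgTensor A B)
    (tmul : ∀ a b, P (tmul A B a b)) (add : ∀ x y, P x → P y → P (x + y)) : P x :=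
  TensorProduct.induction_on x (by have h := tmul 0 0; rw [map_zero] at h; exact h) tmul add

/-- The *-homomorphism `f ⊗ id` on algebraic tensor products. -/
noncomputable def mapLeft (f : A →⋆ₙₐ[ℂ] A') : AlgTensor A B →⋆ₙₐ[ℂ] AlgTensor A' B :=
  let g : AlgTensor A B →ₗ[ℂ] AlgTensor A' B :=
    TensorProduct.map (f : A →ₗ[ℂ] A') (LinearMap.id : B →ₗ[ℂ] B)
  have hg : ∀ a b, g (tmul A B a b) = tmul A' B (f a) b := fun _ _ => rfl
  { toFun := g
    map_smul' := g.map_smul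
    map_zero' := g.map_zero
    map_add' := g.map_add
    map_mul' := fun x y => by
      induction x using induction_on with
      | add x x' hx hx' => rw [add_mul, map_add, hx, hx', map_add, add_mul]
      | tmul a b =>
      induction y using induction_on with
      | add y y' hy hy' => rw [mul_add, map_add, hy, hy', map_add, mul_add]
      | tmul a' b' => rw [tmul_mul_tmul, hg, hg, hg, tmul_mul_tmul, map_mul f]
    map_star' := fun x => by
      induction x using induction_on with
      | add x x' hx hx' => rw [star_add, map_add, hx, hx', map_add, star_add]
      | tmul a b => rw [star_tmul, hg, hg, star_tmul, map_star f] }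

@[simp] lemma mapLeft_tmul (f : A →⋆ₙₐ[ℂ] A') (a : A) (b : B) :
    mapLeft f (tmul A B a b) = tmul A' B (f a) b := rfl

/-- C*-seminorms pull back to C*-seminorms along `f ⊗ id`; the estimate on elementary tensors
survives because `f` is contractive. -/
lemma norm_mapLeft_le (f : A →⋆ₙₐ[ℂ] A') (x : AlgTensor A B) : ‖mapLeft f x‖ ≤ ‖x‖ := by
  refine maxNorm_le fun p => ?_
  let q : Seminorm ℂ (AlgTensor A B) :=
    p.1.comp (mapLeft (B := B) f : AlgTensor A B →ₗ[ℂ] AlgTensor A' B)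
  have hq : ∀ y, q y = p.1 (mapLeft f y) := fun _ => rfl
  have hq' : IsCStarSeminorm q :=
    { mul_le := fun y z => by rw [hq, hq, hq, map_mul]; exact p.2.mul_le _ _
      star_mul_self := fun y => by rw [hq, hq, map_mul, map_star]; exact p.2.star_mul_self _
      tmul_le := fun a b => by
        rw [hq, mapLeft_tmul]
        exact (p.2.tmul_le _ _).trans (mul_le_mul_of_nonneg_right
          (NonUnitalStarAlgHom.norm_apply_le f a) (norm_nonneg b)) }
  exact le_maxNorm ⟨q, hq'⟩ x

end AlgTensor

namespace CStarTensor

open UniformSpace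

variable {A A' B : Type*} [NonUnitalCStarAlgebra A] [NonUnitalCStarAlgebra A']
  [NonUnitalCStarAlgebra B]

lemma uniformContinuous_mapLeft (f : A →⋆ₙₐ[ℂ] A') :
    UniformContinuous (AlgTensor.mapLeft f : AlgTensor A B → AlgTensor A' B) :=
  (AddMonoidHomClass.lipschitz_of_bound (AlgTensor.mapLeft f) 1 fun x => by
    rw [one_mul]; exact AlgTensor.norm_mapLeft_le f x).uniformContinuous

/-- The underlying function of `f ⊗ id`. -/
noncomputable def mapLeftFun (f : A →⋆ₙₐ[ℂ] A') : CStarTensor A B → CStarTensor A' B :=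
  Completion.map (AlgTensor.mapLeft f : AlgTensor A B → AlgTensor A' B)

lemma continuous_mapLeftFun (f : A →⋆ₙₐ[ℂ] A') :
    Continuous (mapLeftFun f : CStarTensor A B → CStarTensor A' B) := Completion.continuous_map

lemma mapLeftFun_of (f : A →⋆ₙₐ[ℂ] A') (x : AlgTensor A B) :
    mapLeftFun f (of x) = of (AlgTensor.mapLeft f x) :=
  Completion.map_coe (uniformContinuous_mapLeft f) x

/-- The *-homomorphism `f ⊗ id` on C*-algebraic tensor products. -/
noncomputable def mapLeft (f : A →⋆ₙₐ[ℂ] A') : CStarTensor A B →⋆ₙₐ[ℂ] CStarTensor A' B where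
  toFun := mapLeftFun f
  map_smul' z x := by
    have := continuous_mapLeftFun (B := B) f
    induction x using induction_on with
    | hc => exact isClosed_eq (this.comp (continuous_const_smul z)) (this.const_smul z)
    | h x => rw [← map_smul, mapLeftFun_of, mapLeftFun_of, map_smul, map_smul]; rfl
  map_zero' := by rw [← map_zero of, mapLeftFun_of, map_zero, map_zero]
  map_add' x y := by
    have := continuous_mapLeftFun (B := B) f
    induction x using induction_on with
    | hc => exact isClosed_eq (by fun_prop) (by fun_prop)
    | h x =>
    induction y using induction_on with
    | hc => exact isClosed_eq (by fun_prop) (by fun_prop)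
    | h y => simp only [← map_add, mapLeftFun_of]
  map_mul' x y := by
    have := continuous_mapLeftFun (B := B) f
    induction x using induction_on with
    | hc => exact isClosed_eq (by fun_prop) (by fun_prop)
    | h x =>
    induction y using induction_on with
    | hc => exact isClosed_eq (by fun_prop) (by fun_prop)
    | h y => simp only [← of_mul, mapLeftFun_of, map_mul]
  map_star' x := by
    have := continuous_mapLeftFun (B := B) f
    induction x using induction_on with
    | hc => exact isClosed_eq (by fun_prop) (by fun_prop)
    | h x => simp only [← of_star, mapLeftFun_of, map_star]

@[simp] lemma mapLeft_tmul (f : A →⋆ₙₐ[ℂ] A') (a : A) (b : B) :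
    mapLeft f (tmul a b) = tmul (f a) b := mapLeftFun_of f _

lemma zero_tmul (b : B) : tmul (0 : A) b = 0 := by simp [tmul]

end CStarTensor

/-! ### Matrix units and isometries permuting them -/

namespace ellTwo

lemma inner_basis (i j : ℕ) : inner ℂ (basis i) (basis j) = if i = j then (1 : ℂ) else 0 := by
  simp [basis, lp.inner_single_left, lp.single_apply, Pi.single_apply]

lemma orthonormal_basis : Orthonormal ℂ basis := orthonormal_iff_ite.2 inner_basis

/-- The isometry of `ℓ²(ℕ)` which maps the `i`-th basis vector to the `τ i`-th one. -/
noncomputable def shift {τ : ℕ → ℕ} (hτ : Function.Injective τ) : ellTwo →ₗᵢ[ℂ] ellTwo :=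
  (orthonormal_basis.comp τ hτ).orthogonalFamily.linearIsometry

lemma shift_basis {τ : ℕ → ℕ} (hτ : Function.Injective τ) (i : ℕ) :
    shift hτ (basis i) = basis (τ i) := by
  rw [shift, basis, OrthogonalFamily.linearIsometry_apply_single]
  simp

lemma unit_mul_unit (i j k l : ℕ) :
    unit i j * unit k l = if j = k then unit i l else 0 := by
  change (InnerProductSpace.rankOne ℂ _ _).comp (InnerProductSpace.rankOne ℂ _ _) = _
  rw [InnerProductSpace.rankOne_comp_rankOne, inner_basis]
  split_ifs <;> simp [unit]

end ellTwo

namespace compactOps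

open ellTwo ContinuousLinearMap

/-- The projection `e_ii` as an element of `𝒦`. -/
noncomputable def diagUnit (i : ℕ) : compactOps := ⟨unit i i, isCompactOperator_unit i i⟩

lemma star_diagUnit (i : ℕ) : star (diagUnit i) = diagUnit i := Subtype.ext (star_unit i i)

lemma diagUnit_mul_self (i : ℕ) : diagUnit i * diagUnit i = diagUnit i :=
  Subtype.ext ((unit_mul_unit i i i i).trans (if_pos rfl))

lemma diagUnit_mul_of_ne {i j : ℕ} (h : i ≠ j) : diagUnit i * diagUnit j = 0 :=
  Subtype.ext ((unit_mul_unit i i j j).trans (if_neg h))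

/-- Conjugation `T ↦ V T V*` by an isometry `V`. -/
noncomputable def conj (V : ellTwo →ₗᵢ[ℂ] ellTwo) : compactOps →⋆ₙₐ[ℂ] compactOps :=
  let W : ellTwo →L[ℂ] ellTwo := V.toContinuousLinearMap
  have hW : star W * W = 1 := (norm_map_iff_adjoint_comp_self W).1 V.norm_map
  { toFun := fun T => ⟨W * T * star W, (T.2.clm_comp W).comp_clm (star W)⟩
    map_smul' := fun z T => Subtype.ext (by simp)
    map_zero' := Subtype.ext (by simp)
    map_add' := fun S T => Subtype.ext (by simp [mul_add, add_mul])
    map_mul' := fun S T => Subtype.ext (by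
      simp only [NonUnitalStarSubalgebra.coe_mul]
      -- Only `W* W = 1` is needed, so non-surjective isometries are allowed.
      calc W * (S * T) * star W = W * S * 1 * T * star W := by simp only [mul_assoc, one_mul]
        _ = _ := by rw [← hW]; simp only [mul_assoc])
    map_star' := fun T => Subtype.ext (by simp [mul_assoc]) }

lemma conj_diagUnit {τ : ℕ → ℕ} (hτ : Function.Injective τ) (i : ℕ) :
    conj (shift hτ) (diagUnit i) = diagUnit (τ i) := by
  refine Subtype.ext ?_
  change (shift hτ).toContinuousLinearMap.comp (InnerProductSpace.rankOne ℂ _ _) ∘L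
    adjoint (shift hτ).toContinuousLinearMap = InnerProductSpace.rankOne ℂ _ _
  rw [InnerProductSpace.rankOne_def', InnerProductSpace.rankOne_def']
  ext1 x
  simp [adjoint_inner_right, shift_basis]

end compactOps

/-! ### Diagonal embeddings and shifts of the stabilization -/

namespace SepCStarAlg

open compactOps BoundedContinuousFunction

variable (A : SepCStarAlg.{u})

/-- The embedding `a ↦ e_ii ⊗ a` of `A` into its stabilization. -/
noncomputable def stabEmbeddingAt (i : ℕ) : A ⟶ A.stabilization :=
  ofHom (CStarTensor.projTensor (diagUnit i) (star_diagUnit i) (diagUnit_mul_self i))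

lemma stabEmbeddingAt_mul_of_ne (i j : ℕ) (h : i ≠ j) (a b : A) :
    (Hom.hom (A.stabEmbeddingAt i) a : A.stabilization) * Hom.hom (A.stabEmbeddingAt j) b = 0 := by
  change CStarTensor.tmul (diagUnit i) a * CStarTensor.tmul (diagUnit j) b = 0
  rw [CStarTensor.tmul_mul_tmul, diagUnit_mul_of_ne h, CStarTensor.zero_tmul]

/-- The endomorphism of `𝒦 ⊗ A` induced by an injection of the index set `ℕ`. -/
noncomputable def stabShift {τ : ℕ → ℕ} (hτ : Function.Injective τ) :
    A.stabilization ⟶ A.stabilization :=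
  ofHom (CStarTensor.mapLeft (conj (ellTwo.shift hτ)))

lemma stabEmbeddingAt_comp_shift {τ : ℕ → ℕ} (hτ : Function.Injective τ) (i : ℕ) :
    A.stabEmbeddingAt i ≫ A.stabShift hτ = A.stabEmbeddingAt (τ i) := by
  refine hom_ext fun a => ?_
  change CStarTensor.mapLeft _ (CStarTensor.tmul (diagUnit i) a) = CStarTensor.tmul _ a
  rw [CStarTensor.mapLeft_tmul, conj_diagUnit]

/-- The diagonal embedding of the null sequences in `A` into `𝒦 ⊗ A`. -/
noncomputable def stabDiag : A.nullSeq ⟶ A.stabilization :=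
  ofHom (diagSum (ε := fun i => Hom.hom (A.stabEmbeddingAt i)) A.stabEmbeddingAt_mul_of_ne)

lemma hasSum_stabDiag (c : _root_.nullSeq A) :
    HasSum (fun i => Hom.hom (A.stabEmbeddingAt i) ((c : ℕ →ᵇ A) i)) (Hom.hom A.stabDiag c) :=
  hasSum_diagSum A.stabEmbeddingAt_mul_of_ne c

lemma hasSum_stabDiag_comp_shift {τ : ℕ → ℕ} (hτ : Function.Injective τ) (c : _root_.nullSeq A) :
    HasSum (fun i => Hom.hom (A.stabEmbeddingAt (τ i)) ((c : ℕ →ᵇ A) (τ i)))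
      (Hom.hom (A.nullSeqRestrict hτ ≫ A.stabDiag ≫ A.stabShift hτ) c) := by
  have h : Continuous (Hom.hom (A.stabShift hτ)) := by
    open scoped CStarAlgebra in exact map_continuous _
  have h1 := (A.hasSum_stabDiag (Hom.hom (A.nullSeqRestrict hτ) c)).map
    (Hom.hom (A.stabShift hτ)) h
  simp only [Function.comp_def, ← comp_apply, stabEmbeddingAt_comp_shift] at h1
  exact h1

end SepCStarAlg

/-! ### The kernel of evaluation at 1 as a cone -/

section Cone

open Filter Topology

/-- The homeomorphism `t ↦ t / (1 + t)` of `[0, ∞)` onto `[0, 1)`, as a map to `[0, 1]`. -/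
noncomputable def compress (t : ℝ≥0) : I :=
  ⟨t / (1 + t), by positivity, div_le_one_of_le₀ (by simp) (by positivity)⟩

lemma coe_compress (t : ℝ≥0) : (compress t : ℝ) = t / (1 + t) := rfl

lemma compress_zero : compress 0 = 0 := Subtype.ext (by simp [coe_compress])

lemma continuous_compress : Continuous compress := by
  refine Continuous.subtype_mk (Continuous.div (by fun_prop) (by fun_prop) fun t => ?_) _
  positivity

lemma tendsto_compress : Tendsto compress atTop (𝓝 1) := by
  rw [tendsto_subtype_rng]
  have h : Tendsto (fun t : ℝ≥0 => 1 - (1 + (t : ℝ))⁻¹) atTop (𝓝 (1 - 0)) :=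
    tendsto_const_nhds.sub (tendsto_inv_atTop_zero.comp
      (tendsto_atTop_add_const_left _ _ (NNReal.tendsto_coe_atTop.2 tendsto_id)))
  rw [sub_zero] at h
  refine h.congr fun t => ?_
  rw [coe_compress]
  have : (1 + (t : ℝ)) ≠ 0 := by positivity
  field_simp
  ring

/-- The map `s ↦ s / (1 - s)` from `[0, 1]` to `[0, ∞)`, inverse to `compress` on `[0, 1)`. -/
noncomputable def expand (s : I) : ℝ≥0 := ⟨s / (1 - s), div_nonneg s.2.1 (by linarith [s.2.2])⟩

lemma coe_expand (s : I) : (expand s : ℝ) = s / (1 - s) := rfl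

lemma compress_expand {s : I} (hs : s ≠ 1) : compress (expand s) = s := by
  have h : (1 - (s : ℝ)) ≠ 0 := fun h => hs (Subtype.ext (sub_eq_zero.1 h).symm)
  refine Subtype.ext ?_
  rw [coe_compress, coe_expand]
  field_simp
  ring

lemma expand_compress (t : ℝ≥0) : expand (compress t) = t := by
  refine NNReal.eq ?_
  rw [coe_expand, coe_compress]
  have : (1 + (t : ℝ)) ≠ 0 := by positivity
  field_simp
  ring

lemma compress_ne_one (t : ℝ≥0) : compress t ≠ 1 := by
  intro h
  have h1 := congrArg (Subtype.val : I → ℝ) h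
  rw [coe_compress, div_eq_iff (by positivity)] at h1
  simp at h1

lemma continuousAt_expand {s : I} (hs : s ≠ 1) : ContinuousAt expand s := by
  have h : (1 - (s : ℝ)) ≠ 0 := fun h => hs (Subtype.ext (sub_eq_zero.1 h).symm)
  rw [ContinuousAt, ← NNReal.tendsto_coe]
  exact ContinuousAt.div (by fun_prop) (by fun_prop) h

lemma tendsto_expand : Tendsto expand (𝓝[≠] 1) atTop := by
  rw [← NNReal.tendsto_coe_atTop]
  have h1 : Tendsto (fun s : I => 1 - (s : ℝ)) (𝓝[≠] 1) (𝓝[>] 0) := by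
    refine tendsto_nhdsWithin_iff.2 ⟨?_, ?_⟩
    · have : Continuous fun s : I => 1 - (s : ℝ) := by fun_prop
      simpa using (this.tendsto 1).mono_left nhdsWithin_le_nhds
    · filter_upwards [self_mem_nhdsWithin] with s hs
      have : (s : ℝ) ≠ 1 := fun h => hs (Subtype.ext h)
      exact sub_pos.2 (lt_of_le_of_ne s.2.2 this)
  have h2 : Tendsto (fun s : I => (s : ℝ)) (𝓝[≠] 1) (𝓝 1) :=
    (continuous_subtype_val.tendsto (1 : I)).mono_left nhdsWithin_le_nhds
  exact h2.pos_mul_atTop one_pos (tendsto_inv_nhdsGT_zero.comp h1)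

namespace SepCStarAlg

variable (A : SepCStarAlg.{u})

/-- The *-homomorphism `ker ev₁ → C₀([0, ∞), A)` given by reparametrization. -/
noncomputable def coneHom : A.kerEvOne →⋆ₙₐ[ℂ] C₀(ℝ≥0, A) where
  toFun f :=
    { toFun := fun t => (f : C(I, A)) (compress t)
      continuous_toFun := (map_continuous (f : C(I, A))).comp continuous_compress
      zero_at_infty' := by
        have h := ((map_continuous (f : C(I, A))).tendsto 1).comp tendsto_compress
        have hf : (f : C(I, A)) 1 = 0 := f.2
        rw [hf] at h
        refine h.mono_left ?_
        rw [cocompact_eq_atTop] }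
  map_smul' _ _ := rfl
  map_zero' := rfl
  map_add' _ _ := rfl
  map_mul' _ _ := rfl
  map_star' _ := rfl

lemma coneHom_apply (f : A.kerEvOne) (t : ℝ≥0) : A.coneHom f t = (f : C(I, A)) (compress t) := rfl

lemma bijective_coneHom : Function.Bijective A.coneHom := by
  classical
  constructor
  · intro f g h
    refine Subtype.ext (ContinuousMap.ext fun s => ?_)
    by_cases hs : s = 1
    · rw [hs, show (f : C(I, A)) 1 = 0 from f.2, show (g : C(I, A)) 1 = 0 from g.2]
    · have := DFunLike.congr_fun h (expand s)
      rwa [coneHom_apply, coneHom_apply, compress_expand hs] at this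
  · intro g
    -- Division by zero gives `expand 1 = 0`, so the value at `1` has to be prescribed; continuity
    -- there is the vanishing of `g` at infinity.
    have hcont : Continuous fun s : I => if s = 1 then 0 else g (expand s) := by
      rw [continuous_iff_continuousAt]
      intro s
      by_cases hs : s = 1
      · subst hs
        rw [continuousAt_iff_punctured_nhds, if_pos rfl]
        have h := (zero_at_infty g).comp (cocompact_eq_atTop (α := ℝ≥0) ▸ tendsto_expand)
        refine h.congr' ?_
        filter_upwards [self_mem_nhdsWithin] with s hs
        exact (if_neg hs).symm
      · refine ((map_continuous g).continuousAt.comp (continuousAt_expand hs)).congr ?_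
        filter_upwards [isOpen_ne.mem_nhds hs] with r hr
        exact (if_neg hr).symm
    refine ⟨⟨⟨_, hcont⟩, if_pos rfl⟩, ?_⟩
    ext t
    rw [coneHom_apply]
    exact (if_neg (compress_ne_one t)).trans (congrArg g (expand_compress t))

lemma exists_coneEquiv :
    ∃ e : A.kerEvOne ≃⋆ₐ[ℂ] C₀(ℝ≥0, A), ∀ f : A.kerEvOne, e f 0 = (f : C(I, A)) 0 :=
  ⟨StarAlgEquiv.ofBijective A.coneHom A.bijective_coneHom, fun f => by
    change A.coneHom f 0 = _
    rw [coneHom_apply, compress_zero]⟩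

end SepCStarAlg

end Cone

/-! ### The binary tree of dyadic intervals -/

section Dyadic

open Filter Topology

/-- The endpoint `(n + 1 + c) / 2 ^ l - 1`, `l = ⌊log₂ (n + 1)⌋`, of the dyadic interval which is
the `n`-th vertex of the binary tree with root `[0, 1]`: the left endpoint for `c = 0`, the midpoint
for `c = 1 / 2` and the right endpoint for `c = 1`. -/
noncomputable def dyadic (c : I) (n : ℕ) : I :=
  ⟨(n + 1 + c) / 2 ^ Nat.log 2 (n + 1) - 1, by
    have h : ((2 ^ Nat.log 2 (n + 1) : ℕ) : ℝ) ≤ (n + 1 : ℕ) :=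
      Nat.cast_le.2 (Nat.pow_log_le_self 2 n.succ_ne_zero)
    push_cast at h
    rw [sub_nonneg, one_le_div (by positivity)]
    linarith [c.2.1], by
    have h : ((n + 2 : ℕ) : ℝ) ≤ ((2 ^ (Nat.log 2 (n + 1) + 1) : ℕ) : ℝ) :=
      Nat.cast_le.2 (Nat.lt_pow_succ_log_self one_lt_two (n + 1))
    push_cast [pow_succ] at h
    rw [sub_le_iff_le_add, div_le_iff₀ (by positivity)]
    linarith [c.2.2]⟩

lemma coe_dyadic (c : I) (n : ℕ) :
    (dyadic c n : ℝ) = (n + 1 + c) / 2 ^ Nat.log 2 (n + 1) - 1 := rfl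

lemma dyadic_apply_zero (c : I) : dyadic c 0 = c := Subtype.ext (by simp [coe_dyadic])

lemma log_two_mul_add_two (n : ℕ) : Nat.log 2 (2 * n + 2) = Nat.log 2 (n + 1) + 1 := by
  rw [show 2 * n + 2 = (n + 1) * 2 by ring, Nat.log_mul_base one_lt_two n.succ_ne_zero]

lemma log_two_mul_add_three (n : ℕ) : Nat.log 2 (2 * n + 3) = Nat.log 2 (n + 1) + 1 := by
  rw [Nat.log_of_one_lt_of_le one_lt_two (by omega)]
  congr 2
  omega

lemma asymptotic_dyadic (c d : I) : Asymptotic (dyadic c) (dyadic d) := by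
  rw [Asymptotic, tendsto_uniformity_iff_dist_tendsto_zero]
  have h0 : Tendsto (fun n : ℕ => 2 * (1 / ((n : ℝ) + 1))) atTop (𝓝 0) := by
    simpa using tendsto_one_div_add_atTop_nhds_zero_nat.const_mul (2 : ℝ)
  refine squeeze_zero (fun _ => dist_nonneg) (fun n => ?_) h0
  -- The `n`-th interval has length `2 ^ (-l)`, and `n + 1 ≤ 2 ^ (l + 1)` bounds this by `2 / (n +
  -- 1)`.
  have h : ((n + 1 : ℕ) : ℝ) ≤ ((2 ^ (Nat.log 2 (n + 1) + 1) : ℕ) : ℝ) :=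
    Nat.cast_le.2 (Nat.lt_pow_succ_log_self one_lt_two (n + 1)).le
  push_cast [pow_succ] at h
  rw [Subtype.dist_eq, Real.dist_eq, coe_dyadic, coe_dyadic, sub_sub_sub_cancel_right, ← sub_div,
    add_sub_add_left_eq_sub, abs_div, abs_of_pos (a := (2 : ℝ) ^ _) (by positivity), mul_one_div,
    div_le_div_iff₀ (by positivity) (by positivity)]
  have h1 : |(c : ℝ) - d| ≤ 1 := by
    rw [abs_le]; constructor <;> linarith [c.2.1, c.2.2, d.2.1, d.2.2]
  nlinarith [abs_nonneg ((c : ℝ) - d)]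

/-- The left child of a vertex of the binary tree. -/
def leftChild (n : ℕ) : ℕ := 2 * n + 1

/-- The right child of a vertex of the binary tree. -/
def rightChild (n : ℕ) : ℕ := 2 * n + 2

lemma leftChild_injective : Function.Injective leftChild := fun m n h => by
  simp only [leftChild] at h; omega

lemma rightChild_injective : Function.Injective rightChild := fun m n h => by
  simp only [rightChild] at h; omega

/-- Passing to a child raises the level by one, and `(2n + 2 + c) / 2 ^ (l + 1) = (n + 1 + c / 2) /
2 ^ l`. The endpoints `c = 0, 1` of the left child are thus the left endpoint and midpoint of the
parent. -/
lemma dyadic_comp_leftChild {c d : I} (h : (d : ℝ) = c / 2) :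
    dyadic c ∘ leftChild = dyadic d := by
  ext n
  simp only [Function.comp_apply, coe_dyadic, leftChild, add_assoc, Nat.reduceAdd,
    log_two_mul_add_two, pow_succ, h]
  push_cast
  field_simp
  ring

lemma dyadic_comp_rightChild {c d : I} (h : (d : ℝ) = (c + 1) / 2) :
    dyadic c ∘ rightChild = dyadic d := by
  ext n
  simp only [Function.comp_apply, coe_dyadic, rightChild, add_assoc, Nat.reduceAdd,
    log_two_mul_add_three, pow_succ, h]
  push_cast
  field_simp
  ring

end Dyadic

/-! ### Decomposition of the diagonal embedding along the tree -/

namespace SepCStarAlg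

variable (A : SepCStarAlg.{u})

/-- Every vertex is the root, a left child or a right child, in exactly one way. -/
lemma stabDiag_apply (c : A.nullSeq) : Hom.hom A.stabDiag c =
    Hom.hom (A.nullSeqEval 0 ≫ A.stabEmbeddingAt 0) c +
      (Hom.hom (A.nullSeqRestrict leftChild_injective ≫ A.stabDiag ≫
        A.stabShift leftChild_injective) c +
      Hom.hom (A.nullSeqRestrict rightChild_injective ≫ A.stabDiag ≫
        A.stabShift rightChild_injective) c) := by
  have h1 := A.hasSum_stabDiag_comp_shift leftChild_injective c
  have h2 := A.hasSum_stabDiag_comp_shift rightChild_injective c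
  -- After the shift by one, even indices `2k` are the left children `2k + 1` and odd indices `2k +
  -- 1` the right children `2k + 2`.
  have h3 := HasSum.even_add_odd (f := fun n => Hom.hom (A.stabEmbeddingAt (n + 1))
    (Hom.hom (A.nullSeqEval (n + 1)) c)) h1 h2
  have h4 := (hasSum_nat_add_iff (f := fun n => Hom.hom (A.stabEmbeddingAt n)
    (Hom.hom (A.nullSeqEval n) c)) 1).1 h3
  rw [Finset.sum_range_one, add_comm] at h4
  exact (A.hasSum_stabDiag c).unique h4

lemma nullSeqEval_mul_shift {τ : ℕ → ℕ} (hτ : Function.Injective τ) (h0 : ∀ n, τ n ≠ 0)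
    (c d : A.nullSeq) :
    (Hom.hom (A.nullSeqEval 0 ≫ A.stabEmbeddingAt 0) c : A.stabilization) *
      Hom.hom (A.nullSeqRestrict hτ ≫ A.stabDiag ≫ A.stabShift hτ) d = 0 := by
  refine ((A.hasSum_stabDiag_comp_shift hτ d).mul_left _).unique ?_
  convert! hasSum_zero using 2 with n
  exact A.stabEmbeddingAt_mul_of_ne _ _ (h0 n).symm _ _

lemma shift_mul_shift {τ τ' : ℕ → ℕ} (hτ : Function.Injective τ) (hτ' : Function.Injective τ')
    (h : ∀ m n, τ m ≠ τ' n) (c d : A.nullSeq) :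
    (Hom.hom (A.nullSeqRestrict hτ ≫ A.stabDiag ≫ A.stabShift hτ) c : A.stabilization) *
      Hom.hom (A.nullSeqRestrict hτ' ≫ A.stabDiag ≫ A.stabShift hτ') d = 0 := by
  refine ((A.hasSum_stabDiag_comp_shift hτ' d).mul_left _).unique ?_
  convert! hasSum_zero using 2 with n
  refine ((A.hasSum_stabDiag_comp_shift hτ c).mul_right _).unique ?_
  convert! hasSum_zero using 2 with m
  exact A.stabEmbeddingAt_mul_of_ne _ _ (h m n) _ _

end SepCStarAlg

/-! ### Stability and the swindle -/

section Functors

open SepCStarAlg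

variable {C : Type v} [Category.{w} C] {F : SepCStarAlg.{u} ⥤ C}

/-- `F` of the embedding at `0` is invertible, so the shift is tested on it alone. The hypothesis
concerns the images under `F` and not `τ 0 = 0`: it applies first to permutations fixing `0`, and
eventually to every injection. -/
lemma StableFunctor.map_stabShift_of_fixed (hF : StableFunctor F) (A : SepCStarAlg.{u})
    {τ : ℕ → ℕ} (hτ : Function.Injective τ)
    (h : F.map (A.stabEmbeddingAt (τ 0)) = F.map (A.stabEmbeddingAt 0)) :
    F.map (A.stabShift hτ) = 𝟙 _ := by
  have : IsIso (F.map (A.stabEmbeddingAt 0)) := hF A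
  rw [← cancel_epi (F.map (A.stabEmbeddingAt 0)), ← F.map_comp, stabEmbeddingAt_comp_shift, h,
    Category.comp_id]

/-- Transpositions of positive indices fix `0`, hence become identities under `F`, so all positive
indices agree. The transposition of `0` and `1` carries the pair of indices `(1, 2)` to `(0, 2)`,
which brings in the index `0`. -/
lemma StableFunctor.map_stabEmbeddingAt (hF : StableFunctor F) (A : SepCStarAlg.{u}) (n : ℕ) :
    F.map (A.stabEmbeddingAt n) = F.map (A.stabEmbeddingAt 0) := by
  have key : ∀ m n, 0 ≠ m → 0 ≠ n →
      F.map (A.stabEmbeddingAt m) = F.map (A.stabEmbeddingAt n) := fun m n hm hn => by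
    have h := hF.map_stabShift_of_fixed A (Equiv.swap m n).injective
      (by rw [Equiv.swap_apply_of_ne_of_ne hm hn])
    have h1 := A.stabEmbeddingAt_comp_shift (Equiv.swap m n).injective m
    rw [Equiv.swap_apply_left] at h1
    rw [← h1, F.map_comp, h, Category.comp_id]
  have h0 := A.stabEmbeddingAt_comp_shift (Equiv.swap 0 1).injective 1
  have h2 := A.stabEmbeddingAt_comp_shift (Equiv.swap 0 1).injective 2
  rw [Equiv.swap_apply_right] at h0
  rw [Equiv.swap_apply_of_ne_of_ne (by decide) (by decide)] at h2
  rcases eq_or_ne 0 n with rfl | hn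
  · rfl
  · rw [key n 2 hn (by decide), ← h2, ← h0, F.map_comp, F.map_comp,
      key 2 1 (by decide) (by decide)]

/-- A stable functor does not see injections of the index set of the compact operators. -/
lemma StableFunctor.map_stabShift (hF : StableFunctor F) (A : SepCStarAlg.{u}) {τ : ℕ → ℕ}
    (hτ : Function.Injective τ) : F.map (A.stabShift hτ) = 𝟙 _ :=
  hF.map_stabShift_of_fixed A hτ (hF.map_stabEmbeddingAt A _)

variable [Preadditive C] [HasBinaryBiproducts C]

/-- The three summands of the tree decomposition are pairwise orthogonal, so `F` is additive on
them, and stability removes the shifts. -/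
lemma map_stabDiag (hF : SplitExactFunctor F) (hs : StableFunctor F) (A : SepCStarAlg.{u}) :
    F.map A.stabDiag = F.map (A.nullSeqEval 0) ≫ F.map (A.stabEmbeddingAt 0) +
      (F.map (A.nullSeqRestrict leftChild_injective) ≫ F.map A.stabDiag +
        F.map (A.nullSeqRestrict rightChild_injective) ≫ F.map A.stabDiag) := by
  obtain ⟨k, hk, hFk⟩ := hF.exists_orthogonal_add (A.shift_mul_shift leftChild_injective
    rightChild_injective fun m n => by simp only [leftChild, rightChild]; omega)
  obtain ⟨l, hl, hFl⟩ := hF.exists_orthogonal_add (f := A.nullSeqEval 0 ≫ A.stabEmbeddingAt 0)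
    (g := k) fun c d => by
      rw [hk, mul_add, A.nullSeqEval_mul_shift _ fun n => by simp [leftChild],
        A.nullSeqEval_mul_shift _ fun n => by simp [rightChild], add_zero]
  have h : l = A.stabDiag := SepCStarAlg.hom_ext fun c => by rw [hl, hk, A.stabDiag_apply]
  rw [h, hFk] at hFl
  simpa only [F.map_comp, hs.map_stabShift, Category.comp_id] using hFl

theorem map_ev_zero_eq_map_ev_one (hF : SplitExactFunctor F) (hs : StableFunctor F)
    (A : SepCStarAlg.{u}) : F.map (A.ev 0) = F.map (A.ev 1) := by
  have : IsIso (F.map (A.stabEmbeddingAt 0)) := hs A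
  let m : I := ⟨1 / 2, by norm_num, by norm_num⟩
  -- The dyadic identities are only propositional, and the sequences occur in the type of the
  -- asymptotics proof.
  have congr_diff : ∀ {x y x' y' : ℕ → I} (h : Asymptotic x y) (h' : Asymptotic x' y'),
      x = x' → y = y' → hF.diff A h = hF.diff A h' := by
    rintro x y _ _ h h' rfl rfl; rfl
  have h := asymptotic_dyadic 0 1
  have h1 := congr_diff (h.comp leftChild_injective) (asymptotic_dyadic 0 m)
    (dyadic_comp_leftChild (by simp)) (dyadic_comp_leftChild (by simp [m]))
  have h2 := congr_diff (h.comp rightChild_injective) (asymptotic_dyadic m 1)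
    (dyadic_comp_rightChild (by simp [m])) (dyadic_comp_rightChild (by simp))
  have key := congrArg (hF.diff A h ≫ ·) (map_stabDiag hF hs A)
  simp only [Preadditive.comp_add, ← Category.assoc, hF.diff_comp_eval, hF.diff_comp_restrict, h1,
    h2, dyadic_apply_zero] at key
  -- The two children recombine through the midpoint to the original difference, so the same term
  -- stands on both sides and cancels; only the root contribution `(F(ev₀) - F(ev₁)) F(e₀₀ ⊗ ·) = 0`
  -- remains.
  rw [← Preadditive.add_comp (f := hF.diff A _), hF.diff_add, eq_comm, add_eq_right,
    Preadditive.IsIso.comp_right_eq_zero, sub_eq_zero] at key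
  exact key

end Functors

theorem mainTheorem5 {C : Type v} [Category.{w} C] [Preadditive C]
    [HasZeroObject C] [HasBinaryBiproducts C]
    (F : SepCStarAlg.{u} ⥤ C) (hsplit : SplitExactFunctor F) (hstable : StableFunctor F) :
    (∀ A : SepCStarAlg.{u},
      (∃ e : A.kerEvOne ≃⋆ₐ[ℂ] C₀(ℝ≥0, A), ∀ f : A.kerEvOne, e f 0 = (f : C(I, A)) 0) ∧
      F.map (A.ev 0) = F.map (A.ev 1)) ∧
    ∀ (A B : SepCStarAlg.{u}) (φ ψ : A ⟶ B),
      SepCStarAlg.Homotopic φ ψ → F.map φ = F.map ψ := by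
  refine ⟨fun A => ⟨A.exists_coneEquiv, map_ev_zero_eq_map_ev_one hsplit hstable A⟩, ?_⟩
  rintro A B _ _ ⟨H, rfl, rfl⟩
  rw [F.map_comp, F.map_comp, map_ev_zero_eq_map_ev_one hsplit hstable B]
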